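/- Let $d \ge 1$ be an integer. For an integrable $u \colon \mathbb{R}^d \to \mathbb{R}$ let \[ \|Du\|(\mathbb{R}^d) = \sup\Big\{ \int_{\mathbb{R}^d} u \operatorname{div} v : v \in C^1_c(\mathbb{R}^d;\mathbb{R}^d),\ |v| \le 1 \Big\}. \] Let $BV([0,1]^d)$ be the space of (classes of) integrable functions $u$ on $\mathbb{R}^d$ with $\|Du\|(\mathbb{R}^d) < \infty$ and $u = 0$ a.e. outside $[0,1]^d$, normed by $\|u\|_{BV} = \|u\|_1 + \|Du\|(\mathbb{R}^d)$. Let $T \colon L^d([0,1]^d) \to BV([0,1]^d)^*$ be the continuous linear operator given by $T_f(u) = \int_{[0,1]^d} f u$, and let $SCH([0,1]^d)$, the space of strong charge functionals, be the closure of the range of $T$ in $BV([0,1]^d)^*$, with the norm of $BV([0,1]^d)^*$. A dyadic cube of generation $n \ge 0$ is a set $\prod_{i=1}^d [2^{-n}c_i, 2^{-n}(c_i+1)]$ with integers $0 \le c_i \le 2^n-1$. For each $n \ge 0$ let $K_{n,k}$, $0 \le k \le 2^{nd}-1$, be an enumeration without repetition of the dyadic cubes of generation $n$, such that for all $n$ and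 $k$ the cubes $K_{n+1,2^dk}, \dots, K_{n+1,2^dk+2^d-1}$ are the $2^d$ dyadic cubes of generation $n+1$ contained in $K_{n,k}$. Let $A_1 = \begin{pmatrix} 1 & 1 \\ 1 & -1 \end{pmatrix}$ and $A_{m+1} = \begin{pmatrix} A_m & A_m \\ A_m & -A_m \end{pmatrix}$, with rows and columns of $A_d$ numbered from $0$ to $2^d-1$. The Haar functions are $g_{-1} = \mathbf{1}_{[0,1]^d}$ and \[ g_{n,k,r} = 2^{nd/2} \sum_{\ell=0}^{2^d-1} (A_d)_{r,\ell}\, \mathbf{1}_{K_{n+1,2^dk+\ell}}, \qquad n \ge 0,\ 0 \le k \le 2^{nd}-1,\ 1 \le r \le 2^d-1; \] they belong to $BV([0,1]^d)$ and to $L^d([0,1]^d)$. Theorem. The sequence $T_{g_{-1}}, T_{g_{0,0,1}}, T_{g_{0,0,2}}, \dots$ (the indices $(n,k,r)$ being ordered lexicographically) is a Schauder basis of $SCH([0,1]^d)$: for each $\alpha \in SCH([0,1]^d)$ there is a unique sequence of real coefficients for which the corresponding series converges to $\alpha$ in norm. The decomposition of $\alpha$ is \[ \alpha = \alpha(g_{-1})\,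 T_{g_{-1}} + \alpha(g_{0,0,1})\, T_{g_{0,0,1}} + \alpha(g_{0,0,2})\, T_{g_{0,0,2}} + \cdots, \] where the series, summed in this order, converges in the norm of $BV([0,1]^d)^*$; in particular the coefficient functionals are the evaluations $\alpha \mapsto \alpha(g)$ at the Haar functions $g$, and they are continuous. -/

import Mathlib

open MeasureTheory Filter Topology
open scoped ENNReal NNReal

namespace StrongCharge

noncomputable section

/-- Euclidean space `ℝᵈ`. -/
abbrev Space (d : ℕ) : Type := EuclideanSpace ℝ (Fin d)

/-- The closed unit cube `[0, 1]ᵈ`. -/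
def unitCube (d : ℕ) : Set (Space d) := {x | ∀ i, x i ∈ Set.Icc (0 : ℝ) 1}

/-- The divergence of a vector field. -/
def divergence {d : ℕ} (v : Space d → Space d) (x : Space d) : ℝ :=
  ∑ i, fderiv ℝ v x (EuclideanSpace.single i 1) i

/-- The vector fields `v ∈ C¹_c(ℝᵈ; ℝᵈ)` with `|v| ≤ 1`. -/
structure IsTestField {d : ℕ} (v : Space d → Space d) : Prop where
  contDiff : ContDiff ℝ 1 v
  hasCompactSupport : HasCompactSupport v
  norm_le_one : ∀ x, ‖v x‖ ≤ 1

/-- The variation `‖Du‖(ℝᵈ)` of an integrable function `u : ℝᵈ → ℝ`. -/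
def variation {d : ℕ} (u : Space d → ℝ) : ℝ≥0∞ :=
  ⨆ (v : Space d → Space d) (_ : IsTestField v), ENNReal.ofReal (∫ x, u x * divergence v x)

/-- `u` is a function of bounded variation on `ℝᵈ` that vanishes a.e. outside `[0, 1]ᵈ`. -/
structure MemBV {d : ℕ} (u : Space d → ℝ) : Prop where
  integrable : Integrable u
  variation_lt_top : variation u < ∞
  ae_eq_zero : ∀ᵐ x, x ∉ unitCube d → u x = 0

section basic

variable {d : ℕ} {u w : Space d → ℝ} {v : Space d → Space d}

theorem IsTestField.zero : IsTestField (fun _ : Space d => (0 : Space d)) :=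
  ⟨contDiff_const, HasCompactSupport.zero, by simp⟩

theorem IsTestField.neg (hv : IsTestField v) : IsTestField (fun x => -v x) :=
  ⟨hv.contDiff.neg, hv.hasCompactSupport.neg, by simpa using hv.norm_le_one⟩

theorem divergence_neg (x : Space d) : divergence (fun x => -v x) x = -divergence v x := by
  simp [divergence, fderiv_fun_neg]

theorem IsTestField.continuous_divergence (hv : IsTestField v) : Continuous (divergence v) := by
  have := hv.contDiff.continuous_fderiv one_ne_zero
  unfold divergence
  fun_prop

theorem IsTestField.hasCompactSupport_divergence (hv : IsTestField v) :
    HasCompactSupport (divergence v) := by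
  refine (hv.hasCompactSupport.fderiv ℝ).mono fun x hx => ?_
  contrapose! hx
  simp only [Function.mem_support, not_not] at hx ⊢
  simp [divergence, hx]

theorem IsTestField.exists_bound (hv : IsTestField v) : ∃ C, ∀ x, ‖divergence v x‖ ≤ C :=
  hv.hasCompactSupport_divergence.exists_bound_of_continuous hv.continuous_divergence

theorem IsTestField.integrable_mul (hv : IsTestField v) (hu : Integrable u) :
    Integrable (fun x => u x * divergence v x) := by
  obtain ⟨C, hC⟩ := hv.exists_bound
  exact hu.mul_bdd hv.continuous_divergence.aestronglyMeasurable (Eventually.of_forall hC)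

theorem IsTestField.ofReal_le (hv : IsTestField v) (u : Space d → ℝ) :
    ENNReal.ofReal (∫ x, u x * divergence v x) ≤ variation u :=
  le_iSup₂ (f := fun (v : Space d → Space d) (_ : IsTestField v) =>
    ENNReal.ofReal (∫ x, u x * divergence v x)) v hv

theorem IsTestField.abs_integral_le (hv : IsTestField v) (hu : variation u < ∞) :
    |∫ x, u x * divergence v x| ≤ (variation u).toReal := by
  have h1 := (ENNReal.ofReal_le_iff_le_toReal hu.ne).1 (hv.ofReal_le u)
  have h2 := (ENNReal.ofReal_le_iff_le_toReal hu.ne).1 (hv.neg.ofReal_le u)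
  simp only [divergence_neg, mul_neg, integral_neg] at h2
  exact _root_.abs_le.2 ⟨by linarith, h1⟩

theorem variation_congr (h : u =ᵐ[volume] w) : variation u = variation w := by
  have (v : Space d → Space d) : ∫ x, u x * divergence v x = ∫ x, w x * divergence v x :=
    integral_congr_ae (h.mono fun x hx => by simp only [hx])
  simp only [variation, this]

theorem variation_add_le (hu : Integrable u) (hw : Integrable w) :
    variation (fun x => u x + w x) ≤ variation u + variation w := by
  refine iSup₂_le fun v hv => ?_
  simp only [add_mul]
  rw [integral_add (hv.integrable_mul hu) (hv.integrable_mul hw)]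
  exact ENNReal.ofReal_add_le.trans (add_le_add (hv.ofReal_le u) (hv.ofReal_le w))

theorem variation_smul_le (c : ℝ) : variation (fun x => c * u x) ≤ ENNReal.ofReal |c| * variation u := by
  refine iSup₂_le fun v hv => ?_
  simp only [mul_assoc]
  rw [integral_const_mul]
  rcases le_total 0 c with hc | hc
  · rw [ENNReal.ofReal_mul hc, abs_of_nonneg hc]
    gcongr
    exact hv.ofReal_le u
  · rw [← neg_mul_neg, ENNReal.ofReal_mul (neg_nonneg.2 hc), abs_of_nonpos hc]
    gcongr
    simpa [divergence_neg, integral_neg] using hv.neg.ofReal_le u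

theorem variation_zero : variation (fun _ : Space d => (0 : ℝ)) = 0 := by
  simp [variation]

theorem MemBV.zero : MemBV (fun _ : Space d => (0 : ℝ)) :=
  ⟨integrable_zero _ _ _, by simp [variation_zero], by simp⟩

theorem MemBV.add (hu : MemBV u) (hw : MemBV w) : MemBV (fun x => u x + w x) :=
  ⟨hu.integrable.add hw.integrable,
    (variation_add_le hu.integrable hw.integrable).trans_lt
      (ENNReal.add_lt_top.2 ⟨hu.variation_lt_top, hw.variation_lt_top⟩), by
    filter_upwards [hu.ae_eq_zero, hw.ae_eq_zero] with x h1 h2 hx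
    simp [h1 hx, h2 hx]⟩

theorem MemBV.const_mul (hu : MemBV u) (c : ℝ) : MemBV (fun x => c * u x) :=
  ⟨hu.integrable.const_mul c,
    (variation_smul_le c).trans_lt (ENNReal.mul_lt_top ENNReal.ofReal_lt_top hu.variation_lt_top), by
    filter_upwards [hu.ae_eq_zero] with x h1 hx
    simp [h1 hx]⟩

theorem MemBV.congr (hu : MemBV u) (h : u =ᵐ[volume] w) : MemBV w :=
  ⟨hu.integrable.congr h, variation_congr h ▸ hu.variation_lt_top, by
    filter_upwards [hu.ae_eq_zero, h] with x h1 h2 hx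
    rw [← h2, h1 hx]⟩

theorem MemBV.sum {ι : Type*} (s : Finset ι) {f : ι → Space d → ℝ} (h : ∀ i ∈ s, MemBV (f i)) :
    MemBV (fun x => ∑ i ∈ s, f i x) := by
  classical
  induction s using Finset.induction_on with
  | empty => simpa using MemBV.zero
  | insert a s ha ih =>
    simp only [Finset.sum_insert ha]
    exact (h a (by simp)).add (ih fun i hi => h i (by simp [hi]))

end basic

/-- The subspace of `L¹(ℝᵈ)` underlying `BV([0, 1]ᵈ)`. -/
def bvSubmodule (d : ℕ) : Submodule ℝ (Lp ℝ 1 (volume : Measure (Space d))) where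
  carrier := {u | MemBV (u : Space d → ℝ)}
  add_mem' {u w} hu hw := (MemBV.add hu hw).congr (Lp.coeFn_add u w).symm
  zero_mem' := MemBV.zero.congr (Lp.coeFn_zero ℝ 1 volume).symm
  smul_mem' c u hu := (MemBV.const_mul hu c).congr (Lp.coeFn_smul c u).symm

/-- The space `BV([0, 1]ᵈ)`; its norm is defined below (it is not the norm of `L¹`). -/
def BV (d : ℕ) : Type := bvSubmodule d

namespace BV

variable {d : ℕ}

instance : AddCommGroup (BV d) := inferInstanceAs (AddCommGroup (bvSubmodule d))
instance : Module ℝ (BV d) := inferInstanceAs (Module ℝ (bvSubmodule d))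

/-- The inclusion of `BV([0, 1]ᵈ)` in `L¹(ℝᵈ)`. -/
def toL1 : BV d →ₗ[ℝ] Lp ℝ 1 (volume : Measure (Space d)) := (bvSubmodule d).subtype

instance : CoeFun (BV d) fun _ => Space d → ℝ := ⟨fun u => (toL1 u : Space d → ℝ)⟩

/-- The element of `BV([0, 1]ᵈ)` given by a function. -/
def mk (u : Space d → ℝ) (hu : MemBV u) : BV d :=
  ⟨(memLp_one_iff_integrable.2 hu.integrable).toLp u,
    hu.congr (memLp_one_iff_integrable.2 hu.integrable).coeFn_toLp.symm⟩

theorem coe_mk (u : Space d → ℝ) (hu : MemBV u) : (mk u hu : Space d → ℝ) =ᵐ[volume] u :=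
  (memLp_one_iff_integrable.2 hu.integrable).coeFn_toLp

theorem memBV (u : BV d) : MemBV (u : Space d → ℝ) := u.2

theorem toL1_injective : Function.Injective (toL1 (d := d)) := Subtype.val_injective

/-- The norm `‖u‖_BV = ‖u‖₁ + ‖Du‖(ℝᵈ)`. -/
instance : Norm (BV d) := ⟨fun u => (∫ x, |u x|) + (variation u).toReal⟩

theorem norm_def (u : BV d) : ‖u‖ = (∫ x, |u x|) + (variation u).toReal := rfl

theorem coe_add (u w : BV d) : (u + w : BV d) =ᵐ[volume] fun x => u x + w x := by
  rw [map_add]; exact Lp.coeFn_add _ _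

theorem coe_smul (c : ℝ) (u : BV d) : (c • u : BV d) =ᵐ[volume] fun x => c * u x := by
  rw [map_smul]; exact Lp.coeFn_smul _ _

theorem norm_smul_le' (c : ℝ) (u : BV d) : ‖c • u‖ ≤ |c| * ‖u‖ := by
  rw [norm_def, norm_def, mul_add]
  gcongr ?_ + ?_
  · rw [integral_congr_ae (g := fun x => |c| * |u x|)
      ((coe_smul c u).mono fun x hx => by simp only [hx, abs_mul]), integral_const_mul]
  · rw [variation_congr (coe_smul c u)]
    refine (ENNReal.toReal_mono (ENNReal.mul_ne_top ENNReal.ofReal_ne_top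
      u.memBV.variation_lt_top.ne) (variation_smul_le c)).trans ?_
    simp

theorem normCore : NormedSpace.Core ℝ (BV d) where
  norm_nonneg u := by rw [norm_def]; positivity
  norm_smul c u := by
    refine le_antisymm (norm_smul_le' c u) ?_
    rcases eq_or_ne c 0 with rfl | hc
    · simp [norm_def]
    · have := norm_smul_le' c⁻¹ (c • u)
      rw [smul_smul, inv_mul_cancel₀ hc, one_smul, abs_inv] at this
      rw [Real.norm_eq_abs]
      have h0 : 0 < |c| := abs_pos.2 hc
      calc |c| * ‖u‖ ≤ |c| * (|c|⁻¹ * ‖c • u‖) := by gcongr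
        _ = ‖c • u‖ := by field_simp
  norm_triangle u w := by
    have hu := u.memBV
    have hw := w.memBV
    simp only [norm_def]
    have h1 : (∫ x, |(u + w : BV d) x|) ≤ (∫ x, |u x|) + ∫ x, |w x| := by
      rw [← integral_add hu.integrable.abs hw.integrable.abs]
      refine integral_mono_ae (u + w).memBV.integrable.abs
        (hu.integrable.abs.add hw.integrable.abs) ?_
      filter_upwards [coe_add u w] with x hx
      rw [hx]
      exact abs_add_le (u x) (w x)
    have h2 : (variation (u + w : BV d)).toReal ≤ (variation u).toReal + (variation w).toReal := by
      rw [variation_congr (coe_add u w), ← ENNReal.toReal_add hu.variation_lt_top.ne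
        hw.variation_lt_top.ne]
      exact ENNReal.toReal_mono (ENNReal.add_ne_top.2
        ⟨hu.variation_lt_top.ne, hw.variation_lt_top.ne⟩)
        (variation_add_le hu.integrable hw.integrable)
    linarith
  norm_eq_zero_iff u := by
    constructor
    · intro h
      rw [norm_def] at h
      have h1 : (∫ x, |u x|) = 0 :=
        le_antisymm (by linarith [ENNReal.toReal_nonneg (a := variation u)]) (by positivity)
      rw [integral_eq_zero_iff_of_nonneg (fun x => abs_nonneg _) u.memBV.integrable.abs] at h1
      refine toL1_injective ?_
      rw [map_zero]
      refine Lp.ext ?_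
      filter_upwards [h1, Lp.coeFn_zero ℝ 1 (volume : Measure (Space d))] with x hx h0
      rw [h0]
      simpa using hx
    · rintro rfl
      have h0 : ((0 : BV d) : Space d → ℝ) =ᵐ[volume] fun _ => 0 := by
        rw [map_zero]; exact Lp.coeFn_zero _ _ _
      rw [norm_def, variation_congr h0, variation_zero,
        integral_congr_ae (g := fun _ => 0) (h0.mono fun x hx => by simp only [hx, abs_zero])]
      simp

instance : NormedAddCommGroup (BV d) := NormedAddCommGroup.ofCore normCore
instance : NormedSpace ℝ (BV d) := NormedSpace.ofCore normCore

theorem norm_eq (u : BV d) : ‖u‖ = (∫ x, |u x|) + (variation u).toReal := rfl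

end BV

section sobolev

theorem unitCube_eq (d : ℕ) : unitCube d = WithLp.ofLp ⁻¹' Set.Icc (0 : Fin d → ℝ) 1 := by
  ext x
  simp [unitCube, Set.mem_Icc, Pi.le_def, forall_and]

theorem isCompact_unitCube (d : ℕ) : IsCompact (unitCube d) := by
  rw [unitCube_eq]
  exact (PiLp.continuousLinearEquiv 2 ℝ (fun _ : Fin d => ℝ)).toHomeomorph.isCompact_preimage.2
    isCompact_Icc

variable {d : ℕ} {u w : Space d → ℝ}

theorem isTestField_single {ψ : Space d → ℝ} (i : Fin d) (h : ContDiff ℝ 1 ψ)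
    (hc : HasCompactSupport ψ) (h1 : ∀ x, |ψ x| ≤ 1) :
    IsTestField (fun x => ψ x • EuclideanSpace.single i (1 : ℝ)) :=
  ⟨h.smul contDiff_const, hc.smul_right, fun x => by simpa [norm_smul] using h1 x⟩

theorem divergence_single {ψ : Space d → ℝ} (i : Fin d) (h : ContDiff ℝ 1 ψ) (x : Space d) :
    divergence (fun x => ψ x • EuclideanSpace.single i (1 : ℝ)) x =
      fderiv ℝ ψ x (EuclideanSpace.single i 1) := by
  have hd : DifferentiableAt ℝ ψ x := h.differentiable one_ne_zero x
  simp only [divergence]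
  rw [fderiv_smul_const hd]
  simp only [ContinuousLinearMap.smulRight_apply, PiLp.smul_apply, smul_eq_mul]
  rw [Finset.sum_eq_single i]
  · simp
  · intro j _ hj
    simp [hj]
  · simp

theorem integral_abs_partial_le (hw : ContDiff ℝ 2 w) (hc : HasCompactSupport w)
    (hV : variation w < ∞) (i : Fin d) :
    ∫ x, |fderiv ℝ w x (EuclideanSpace.single i 1)| ≤ (variation w).toReal := by
  set e : Space d := EuclideanSpace.single i 1 with he
  set p : Space d → ℝ := fun x => fderiv ℝ w x e with hp
  have hp1 : ContDiff ℝ 1 p := (hw.fderiv_right (m := 1) (by norm_num)).clm_apply contDiff_const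
  have hpc : HasCompactSupport p := hc.fderiv_apply ℝ e
  set S := tsupport p with hS
  have hSm : MeasurableSet S := (isClosed_tsupport p).measurableSet
  have hSf : volume S < ∞ := hpc.isCompact.measure_lt_top
  have key (δ : ℝ) (hδ : 0 < δ) : ∫ x, |p x| ≤ (variation w).toReal + δ * (volume S).toReal := by
    have hpos (x : Space d) : 0 < p x ^ 2 + δ ^ 2 := by positivity
    set ψ : Space d → ℝ := fun x => -(p x / √(p x ^ 2 + δ ^ 2)) with hψ
    have hψ1 : ContDiff ℝ 1 ψ := by
      refine (hp1.div (((hp1.pow 2).add contDiff_const).sqrt fun x => (hpos x).ne') fun x => ?_).neg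
      exact (Real.sqrt_pos.2 (hpos x)).ne'
    have hψc : HasCompactSupport ψ := by
      refine hpc.mono fun x hx => ?_
      contrapose! hx
      simp only [Function.mem_support, not_not] at hx ⊢
      simp [hψ, hx]
    have hψb (x : Space d) : |ψ x| ≤ 1 := by
      rw [hψ, abs_neg, abs_div, abs_of_pos (Real.sqrt_pos.2 (hpos x)),
        div_le_one (Real.sqrt_pos.2 (hpos x))]
      exact Real.abs_le_sqrt (by nlinarith)
    have hT := isTestField_single i hψ1 hψc hψb
    have h1 := (le_abs_self _).trans (hT.abs_integral_le hV)
    simp only [divergence_single i hψ1] at h1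
    have hwi : Integrable w := hw.continuous.integrable_of_hasCompactSupport hc
    have hcont : Continuous fun x => fderiv ℝ ψ x e := by
      have := hψ1.continuous_fderiv one_ne_zero
      fun_prop
    rw [integral_mul_fderiv_eq_neg_fderiv_mul_of_integrable] at h1
    rotate_left
    · exact (hp1.continuous.mul hψ1.continuous).integrable_of_hasCompactSupport hpc.mul_right
    · exact (hw.continuous.mul hcont).integrable_of_hasCompactSupport hc.mul_right
    · exact (hw.continuous.mul hψ1.continuous).integrable_of_hasCompactSupport hc.mul_right
    · exact fun x _ => hw.differentiable two_ne_zero x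
    · exact fun x _ => hψ1.differentiable one_ne_zero x
    have hI : Integrable (fun x => p x * ψ x) :=
      (hp1.continuous.mul hψ1.continuous).integrable_of_hasCompactSupport hpc.mul_right
    have hJ : Integrable (S.indicator fun _ : Space d => δ) :=
      (integrable_indicator_iff hSm).2 (integrableOn_const hSf.ne)
    have h2 : ∫ x, |p x| ≤ ∫ x, (-(p x * ψ x) + S.indicator (fun _ => δ) x) := by
      refine integral_mono (hp1.continuous.integrable_of_hasCompactSupport hpc).abs
        (hI.neg.add hJ) fun x => ?_
      by_cases hx : x ∈ S
      · simp only [Set.indicator_of_mem hx, hψ]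
        set s := √(p x ^ 2 + δ ^ 2) with hs
        have hs0 : 0 < s := Real.sqrt_pos.2 (hpos x)
        have hs2 : s ^ 2 = p x ^ 2 + δ ^ 2 := Real.sq_sqrt (hpos x).le
        have hsp : |p x| ≤ s := Real.abs_le_sqrt (by nlinarith)
        have hsd : δ ≤ s := Real.le_sqrt_of_sq_le (by nlinarith)
        have : -(p x * -(p x / s)) = s - δ * (δ / s) := by
          field_simp
          nlinarith
        rw [this]
        have : δ * (δ / s) ≤ δ * 1 := by
          gcongr
          exact (div_le_one hs0).2 hsd
        linarith
      · simp [image_eq_zero_of_notMem_tsupport hx, Set.indicator_of_notMem hx]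
    rw [integral_add (f := fun x => -(p x * ψ x)) hI.neg hJ, integral_neg, integral_indicator hSm,
      setIntegral_const] at h2
    simp only [smul_eq_mul, Measure.real] at h2
    linarith
  refine le_of_forall_pos_le_add fun ε hε => ?_
  have hv0 : 0 ≤ (volume S).toReal := ENNReal.toReal_nonneg
  refine (key (ε / ((volume S).toReal + 1)) (by positivity)).trans ?_
  gcongr
  rw [div_mul_eq_mul_div, div_le_iff₀ (by positivity)]
  nlinarith

theorem eLpNorm_fderiv_le (hw : ContDiff ℝ 2 w) (hc : HasCompactSupport w)
    (hV : variation w < ∞) : eLpNorm (fderiv ℝ w) 1 volume ≤ d * variation w := by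
  have hcont : Continuous (fderiv ℝ w) := hw.continuous_fderiv two_ne_zero
  rw [eLpNorm_one_eq_lintegral_enorm]
  calc ∫⁻ x, ‖fderiv ℝ w x‖ₑ
      ≤ ∫⁻ x, ∑ i : Fin d, ‖fderiv ℝ w x (EuclideanSpace.single i 1)‖ₑ := by
        refine lintegral_mono fun x => ?_
        have : ‖fderiv ℝ w x‖ ≤ ∑ i : Fin d, ‖fderiv ℝ w x (EuclideanSpace.single i 1)‖ := by
          refine ContinuousLinearMap.opNorm_le_bound _ (by positivity) fun y => ?_
          have hy : y = ∑ i, y i • EuclideanSpace.single i (1 : ℝ) := by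
            ext j
            simp [Finset.sum_apply, Pi.single_apply]
          conv_lhs => rw [hy, map_sum]
          rw [Finset.sum_mul]
          refine (norm_sum_le _ _).trans (Finset.sum_le_sum fun i _ => ?_)
          rw [map_smul, norm_smul, mul_comm]
          gcongr
          exact PiLp.norm_apply_le y i
        rw [← ofReal_norm]
        refine (ENNReal.ofReal_le_ofReal this).trans ?_
        rw [ENNReal.ofReal_sum_of_nonneg fun i _ => norm_nonneg _]
        simp only [ofReal_norm, le_refl]
    _ = ∑ i : Fin d, ∫⁻ x, ‖fderiv ℝ w x (EuclideanSpace.single i 1)‖ₑ := by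
        rw [lintegral_finsetSum]
        intro i _
        exact (by fun_prop : Continuous _).measurable
    _ ≤ ∑ _i : Fin d, variation w := by
        refine Finset.sum_le_sum fun i _ => ?_
        have hi : Integrable fun x => fderiv ℝ w x (EuclideanSpace.single i 1) :=
          (by fun_prop : Continuous fun x => fderiv ℝ w x (EuclideanSpace.single i 1)
            ).integrable_of_hasCompactSupport (hc.fderiv_apply ℝ _)
        rw [← ofReal_integral_norm_eq_lintegral_enorm hi]
        exact ENNReal.ofReal_le_of_le_toReal (integral_abs_partial_le hw hc hV i)
    _ = d * variation w := by simp

theorem IsTestField.comp_add {v : Space d → Space d} (hv : IsTestField v) (t : Space d) :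
    IsTestField (fun x => v (x + t)) :=
  ⟨hv.contDiff.comp (contDiff_id.add contDiff_const),
    hv.hasCompactSupport.comp_homeomorph (Homeomorph.addRight t), fun _ => hv.norm_le_one _⟩

theorem divergence_comp_add {v : Space d → Space d} (t x : Space d) :
    divergence (fun x => v (x + t)) x = divergence v (x + t) := by
  simp [divergence, fderiv_comp_add_right]

theorem variation_convolution_le (φ : ContDiffBump (0 : Space d)) (hu : Integrable u)
    (hV : variation u < ∞) :
    variation (convolution (φ.normed volume) u (ContinuousLinearMap.lsmul ℝ ℝ) volume) ≤
      variation u := by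
  refine iSup₂_le fun v hv => ENNReal.ofReal_le_of_le_toReal ?_
  set ρ : Space d → ℝ := φ.normed volume with hρ
  have hρi : Integrable ρ := φ.integrable_normed
  obtain ⟨C, hC⟩ := hv.exists_bound
  have hint : Integrable (Function.uncurry fun x t : Space d => ρ t * u (x - t) * divergence v x)
      (volume.prod volume) := by
    have h1 := hρi.convolution_integrand (ContinuousLinearMap.lsmul ℝ ℝ) hu
    exact h1.mul_bdd (c := C)
      (hv.continuous_divergence.comp continuous_fst).aestronglyMeasurable
      (Eventually.of_forall fun p => hC p.1)
  have hinner (t : Space d) : ∫ x, ρ t * u (x - t) * divergence v x =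
      ρ t * ∫ x, u x * divergence (fun y => v (y + t)) x := by
    simp only [mul_assoc, divergence_comp_add]
    rw [integral_const_mul, ← integral_sub_right_eq_self (fun x => u x * divergence v (x + t)) t]
    simp
  calc ∫ x, convolution ρ u (ContinuousLinearMap.lsmul ℝ ℝ) volume x * divergence v x
      = ∫ x, ∫ t, ρ t * u (x - t) * divergence v x := by
        refine integral_congr_ae (Eventually.of_forall fun x => ?_)
        simp only [convolution, ContinuousLinearMap.lsmul_apply, smul_eq_mul]
        rw [integral_mul_const]
    _ = ∫ t, ∫ x, ρ t * u (x - t) * divergence v x := integral_integral_swap hint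
    _ ≤ ∫ t, ρ t * (variation u).toReal := by
        refine integral_mono hint.integral_prod_right (hρi.mul_const _) fun t => ?_
        change ∫ x, ρ t * u (x - t) * divergence v x ≤ _
        rw [hinner]
        exact mul_le_mul_of_nonneg_left ((le_abs_self _).trans ((hv.comp_add t).abs_integral_le hV))
          (φ.nonneg_normed t)
    _ = (variation u).toReal := by
        rw [integral_mul_const, hρ, φ.integral_normed, one_mul]

theorem enorm_le_eLpNorm_fderiv {w : Space 1 → ℝ} (hw : ContDiff ℝ 1 w) (hc : HasCompactSupport w)
    (x : Space 1) : ‖w x‖ₑ ≤ eLpNorm (fderiv ℝ w) 1 volume := by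
  set e : Space 1 := EuclideanSpace.single 0 1 with he
  have hw' : ContDiff ℝ 1 (fun t : ℝ => w (t • e)) :=
    hw.comp (contDiff_id.smul contDiff_const)
  have hmp : MeasurePreserving (fun t : ℝ => t • e) volume volume := by
    have := (PiLp.volume_preserving_toLp (Fin 1)).comp (volume_preserving_funUnique (Fin 1) ℝ).symm
    have hf : (fun t : ℝ => t • e) =
        (WithLp.toLp 2 ∘ (MeasurableEquiv.funUnique (Fin 1) ℝ).symm : ℝ → Space 1) := by
      funext t
      ext i
      fin_cases i
      simp [he, MeasurableEquiv.funUnique]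
    rw [hf]
    exact this
  have hwc : HasCompactSupport (fun t : ℝ => w (t • e)) := by
    refine hc.comp_isClosedEmbedding (g := fun t : ℝ => t • e)
      (LinearMap.isClosedEmbedding_of_injective (f := LinearMap.toSpanSingleton ℝ _ e) ?_)
    rw [LinearMap.ker_toSpanSingleton]
    simp [he]
  have hx : x = x 0 • e := by
    ext i
    fin_cases i
    simp [he]
  have hcont : Continuous (fderiv ℝ w) := hw.continuous_fderiv one_ne_zero
  rw [eLpNorm_one_eq_lintegral_enorm, ← hmp.lintegral_comp hcont.measurable.enorm]
  conv_lhs => rw [hx]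
  refine (HasCompactSupport.enorm_le_lintegral_Ici_deriv hw' hwc (x 0)).trans
    ((setLIntegral_le_lintegral _ _).trans (lintegral_mono fun t => ?_))
  have hder : HasDerivAt (fun t : ℝ => w (t • e)) (fderiv ℝ w (t • e) e) t := by
    have h1 : HasDerivAt (fun t : ℝ => t • e) e t := by
      simpa using (hasDerivAt_id t).smul_const e
    exact ((hw.differentiable one_ne_zero (t • e)).hasFDerivAt).comp_hasDerivAt t h1
  rw [hder.deriv]
  refine (ContinuousLinearMap.le_opENorm _ _).trans ?_
  have h1 : ‖e‖ₑ = 1 := by rw [← ofReal_norm]; simp [he]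
  rw [h1, mul_one]

/-- The Sobolev inequality for smooth functions, including the one-dimensional case. -/
theorem exists_sobolev_smooth (d : ℕ) [NeZero d] (q : ℝ≥0∞) [hq : ENNReal.HolderConjugate d q] :
    ∃ C : ℝ≥0, ∀ w : Space d → ℝ, ContDiff ℝ 1 w → HasCompactSupport w →
      eLpNorm w q volume ≤ C * eLpNorm (fderiv ℝ w) 1 volume := by
  have hsum := ENNReal.HolderConjugate.inv_add_inv_eq_one (d : ℝ≥0∞) q
  rcases eq_or_ne d 1 with rfl | hd
  · have hq : q = ∞ := by simpa using hsum
    subst hq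
    refine ⟨1, fun w hw hc => ?_⟩
    rw [eLpNorm_exponent_top, ENNReal.coe_one, one_mul]
    exact eLpNormEssSup_le_of_ae_enorm_bound
      (Eventually.of_forall fun x => enorm_le_eLpNorm_fderiv hw hc x)
  · have hd2 : 1 < d := by have := NeZero.pos d; omega
    have hqt : q ≠ ∞ := by
      rintro rfl
      simp at hsum
      omega
    lift q to ℝ≥0 using hqt
    refine ⟨eLpNormLESNormFDerivOneConst (volume : Measure (Space d)) q, fun w hw hc => ?_⟩
    refine eLpNorm_le_eLpNorm_fderiv_one volume hw hc ?_
    rw [finrank_euclideanSpace_fin]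
    have : (d : ℝ≥0∞) = ((d : ℝ≥0) : ℝ≥0∞) := by simp
    rw [this] at hq
    have h1 : (1 : ℝ≥0) < ((d : ℝ≥0) : ℝ≥0∞).toNNReal := by simpa using hd2
    simpa using ENNReal.HolderConjugate.toNNReal h1 (q := (q : ℝ≥0∞))

/-- The Sobolev inequality `‖u‖_{d/(d-1)} ≤ C ‖Du‖(ℝᵈ)` on `BV([0, 1]ᵈ)`. -/
theorem exists_sobolev (d : ℕ) [NeZero d] (q : ℝ≥0∞) [ENNReal.HolderConjugate d q] :
    ∃ C : ℝ≥0, ∀ u : Space d → ℝ, MemBV u → eLpNorm u q volume ≤ C * variation u := by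
  obtain ⟨C, hC⟩ := exists_sobolev_smooth d q
  refine ⟨C * d, fun u₀ hu₀ => ?_⟩
  set u : Space d → ℝ := (unitCube d).indicator u₀ with hudef
  have huu : u₀ =ᵐ[volume] u := by
    filter_upwards [hu₀.ae_eq_zero] with x hx
    by_cases h : x ∈ unitCube d
    · simp [hudef, h]
    · simp [hudef, h, hx h]
  have hu : MemBV u := hu₀.congr huu
  rw [eLpNorm_congr_ae huu, variation_congr huu]
  have huc : HasCompactSupport u := by
    refine HasCompactSupport.of_support_subset_isCompact (isCompact_unitCube d) ?_
    exact Set.support_indicator_subset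
  let φ (n : ℕ) : ContDiffBump (0 : Space d) :=
    ⟨1 / (n + 1), 2 * (1 / (n + 1)), by positivity, by
      have : (0 : ℝ) < 1 / (n + 1) := by positivity
      linarith⟩
  let W (n : ℕ) : Space d → ℝ :=
    convolution ((φ n).normed volume) u (ContinuousLinearMap.lsmul ℝ ℝ) volume
  have hWs (n : ℕ) : ContDiff ℝ 2 (W n) :=
    (φ n).hasCompactSupport_normed.contDiff_convolution_left (n := 2) _
      (φ n).contDiff_normed hu.integrable.locallyIntegrable
  have hWc (n : ℕ) : HasCompactSupport (W n) :=
    (φ n).hasCompactSupport_normed.convolution _ huc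
  have hlim : ∀ᵐ x, Tendsto (fun n => W n x) atTop (𝓝 (u x)) := by
    refine ContDiffBump.ae_convolution_tendsto_right_of_locallyIntegrable (K := 2) ?_ ?_
      hu.integrable.locallyIntegrable
    · have := (tendsto_one_div_add_atTop_nhds_zero_nat (𝕜 := ℝ)).const_mul 2
      rw [mul_zero] at this
      exact this
    · exact Eventually.of_forall fun n => le_rfl
  refine (Lp.eLpNorm_lim_le_liminf_eLpNorm
    (fun n => (hWs n).continuous.aestronglyMeasurable) u hlim).trans ?_
  refine liminf_le_of_le (by isBoundedDefault) fun b hb => ?_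
  obtain ⟨n, hn⟩ := hb.exists
  refine hn.trans ((hC _ ((hWs n).of_le (by norm_num)) (hWc n)).trans ?_)
  have hle := variation_convolution_le (φ n) hu.integrable hu.variation_lt_top
  have := (eLpNorm_fderiv_le (hWs n) (hWc n) (hle.trans_lt hu.variation_lt_top)).trans
    (mul_le_mul_right hle _)
  push_cast
  rw [mul_assoc]
  gcongr

end sobolev

/-- Lebesgue measure on `[0, 1]ᵈ`. -/
abbrev cubeMeasure (d : ℕ) : Measure (Space d) := volume.restrict (unitCube d)

instance factOneLe (d : ℕ) [NeZero d] : Fact (1 ≤ (d : ℝ≥0∞)) :=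
  ⟨by exact_mod_cast NeZero.pos d⟩

theorem holder_pairing {α : Type*} [MeasurableSpace α] {μ : Measure α} {p q : ℝ≥0∞}
    (hpq : ENNReal.HolderConjugate p q) {f u : α → ℝ} (hf : MemLp f p μ) (hu : MemLp u q μ) :
    Integrable (fun x => f x * u x) μ ∧
      |∫ x, f x * u x ∂μ| ≤ (eLpNorm f p μ).toReal * (eLpNorm u q μ).toReal := by
  have hint : Integrable (fun x => f x * u x) μ := hf.integrable_mul hu
  have h1 : eLpNorm (fun x => f x * u x) 1 μ ≤ eLpNorm f p μ * eLpNorm u q μ :=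
    eLpNorm_smul_le_mul_eLpNorm (p := p) (q := q) (r := 1) (f := u) (φ := f) hu.1 hf.1
  refine ⟨hint, ?_⟩
  rw [← Real.norm_eq_abs]
  calc ‖∫ x, f x * u x ∂μ‖ ≤ ∫ x, ‖f x * u x‖ ∂μ := norm_integral_le_integral_norm _
    _ = (eLpNorm (fun x => f x * u x) 1 μ).toReal := by
        rw [integral_norm_eq_lintegral_enorm hint.1, eLpNorm_one_eq_lintegral_enorm]
    _ ≤ _ := by
        rw [← ENNReal.toReal_mul]
        exact ENNReal.toReal_mono (ENNReal.mul_ne_top hf.2.ne hu.2.ne) h1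

theorem exists_pairing_bound (d : ℕ) [NeZero d] :
    ∃ C : ℝ, ∀ (f : Lp ℝ d (cubeMeasure d)) (u : BV d),
      Integrable (fun x => f x * u x) (cubeMeasure d) ∧
      |∫ x in unitCube d, f x * u x| ≤ C * ‖f‖ * ‖u‖ := by
  have hq : ENNReal.HolderConjugate (d : ℝ≥0∞) (ENNReal.conjExponent d) :=
    ENNReal.HolderConjugate.conjExponent (Fact.out : 1 ≤ (d : ℝ≥0∞))
  generalize ENNReal.conjExponent (d : ℝ≥0∞) = q at hq
  obtain ⟨C, hC⟩ := exists_sobolev d q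
  refine ⟨C, fun f u => ?_⟩
  have hub := u.memBV
  have hlt : C * variation (u : Space d → ℝ) < ∞ :=
    ENNReal.mul_lt_top ENNReal.coe_lt_top hub.variation_lt_top
  have hle : eLpNorm (u : Space d → ℝ) q (cubeMeasure d) ≤ C * variation (u : Space d → ℝ) :=
    (eLpNorm_mono_measure _ Measure.restrict_le_self).trans (hC _ hub)
  have hu : MemLp (u : Space d → ℝ) q (cubeMeasure d) :=
    ⟨hub.integrable.aestronglyMeasurable.mono_measure Measure.restrict_le_self, hle.trans_lt hlt⟩
  obtain ⟨h1, h2⟩ := holder_pairing hq (Lp.memLp f) hu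
  refine ⟨h1, h2.trans ?_⟩
  have h3 : (eLpNorm (u : Space d → ℝ) q (cubeMeasure d)).toReal ≤ C * ‖u‖ := by
    refine (ENNReal.toReal_mono hlt.ne hle).trans ?_
    rw [ENNReal.toReal_mul, ENNReal.coe_toReal, BV.norm_eq]
    have : 0 ≤ ∫ x, |u x| := integral_nonneg fun x => abs_nonneg _
    exact mul_le_mul_of_nonneg_left (by linarith) C.2
  rw [← Lp.norm_def, mul_comm (C : ℝ), mul_assoc]
  exact mul_le_mul_of_nonneg_left h3 (norm_nonneg f)

/-- The operator `T : L^d([0, 1]ᵈ) → BV([0, 1]ᵈ)^*`, `T_f(u) = ∫_{[0, 1]ᵈ} f u`. -/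
def T (d : ℕ) [NeZero d] : Lp ℝ d (cubeMeasure d) →L[ℝ] StrongDual ℝ (BV d) :=
  LinearMap.mkContinuous₂
    (LinearMap.mk₂ ℝ (fun (f : Lp ℝ d (cubeMeasure d)) (u : BV d) => ∫ x in unitCube d, f x * u x)
      (fun f g u => by
        obtain ⟨C, h⟩ := exists_pairing_bound d
        rw [← integral_add (h f u).1 (h g u).1]
        refine integral_congr_ae ?_
        filter_upwards [Lp.coeFn_add f g] with x hx
        rw [hx, Pi.add_apply, add_mul])
      (fun c f u => by
        rw [smul_eq_mul, ← integral_const_mul]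
        refine integral_congr_ae ?_
        filter_upwards [Lp.coeFn_smul c f] with x hx
        rw [hx, Pi.smul_apply, smul_eq_mul, mul_assoc])
      (fun f u w => by
        obtain ⟨C, h⟩ := exists_pairing_bound d
        rw [← integral_add (h f u).1 (h f w).1]
        refine integral_congr_ae ?_
        filter_upwards [ae_restrict_of_ae (BV.coe_add u w)] with x hx
        rw [hx, mul_add])
      (fun c f u => by
        rw [smul_eq_mul, ← integral_const_mul]
        refine integral_congr_ae ?_
        filter_upwards [ae_restrict_of_ae (BV.coe_smul c u)] with x hx
        rw [hx, mul_left_comm]))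
    (exists_pairing_bound d).choose
    (fun f u => ((exists_pairing_bound d).choose_spec f u).2)

theorem T_apply (d : ℕ) [NeZero d] (f : Lp ℝ d (cubeMeasure d)) (u : BV d) :
    T d f u = ∫ x in unitCube d, f x * u x := rfl

/-- The space `SCH([0, 1]ᵈ)` of strong charge functionals: the closure of the range of `T` in
`BV([0, 1]ᵈ)^*`, with the norm of `BV([0, 1]ᵈ)^*`. -/
def SCH (d : ℕ) [NeZero d] : Submodule ℝ (StrongDual ℝ (BV d)) :=
  (LinearMap.range (T d : Lp ℝ d (cubeMeasure d) →ₗ[ℝ] StrongDual ℝ (BV d))).topologicalClosure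

/-- `T_f` as an element of `SCH([0, 1]ᵈ)`. -/
def strongCharge {d : ℕ} [NeZero d] (f : Lp ℝ d (cubeMeasure d)) : SCH d :=
  ⟨T d f, Submodule.le_topologicalClosure _ ⟨f, rfl⟩⟩

/-- The closed box `∏ [a i, b i]`. -/
def box {d : ℕ} (a b : Fin d → ℝ) : Set (Space d) := {x | ∀ i, x i ∈ Set.Icc (a i) (b i)}

section box

variable {d : ℕ}

theorem box_eq (a b : Fin d → ℝ) : box a b = WithLp.ofLp ⁻¹' Set.Icc a b := by
  ext x
  simp [box, Set.mem_Icc, Pi.le_def, forall_and]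

theorem isCompact_box (a b : Fin d → ℝ) : IsCompact (box a b) := by
  rw [box_eq]
  exact (PiLp.continuousLinearEquiv 2 ℝ (fun _ : Fin d => ℝ)).toHomeomorph.isCompact_preimage.2
    isCompact_Icc

theorem variation_box_lt_top {a b : Fin d → ℝ} (hab : a ≤ b) :
    variation ((box a b).indicator fun _ => (1 : ℝ)) < ∞ := by
  cases d with
  | zero => simp [variation, divergence]
  | succ m =>
  let B : ℝ := ∑ i : Fin (m + 1),
    2 * (volume (Set.Icc (a ∘ i.succAbove) (b ∘ i.succAbove))).toReal
  refine lt_of_le_of_lt (iSup₂_le fun v hv => ENNReal.ofReal_le_ofReal ?_)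
    (ENNReal.ofReal_lt_top (r := B))
  let L := (PiLp.continuousLinearEquiv 2 ℝ (fun _ : Fin (m + 1) => ℝ)).symm
  have hL (y : Fin (m + 1) → ℝ) : L y = WithLp.toLp 2 y := rfl
  have hmp : MeasurePreserving L volume volume := PiLp.volume_preserving_toLp (Fin (m + 1))
  have hme : MeasurableEmbedding L := L.toHomeomorph.measurableEmbedding
  have hpre : L ⁻¹' box a b = Set.Icc a b := by
    ext y
    simp [box, hL, Set.mem_Icc, Pi.le_def, forall_and]
  have hvL : ContDiff ℝ 1 (fun y => v (L y)) := hv.contDiff.comp L.contDiff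
  let f' (i : Fin (m + 1)) (y : Fin (m + 1) → ℝ) : (Fin (m + 1) → ℝ) →L[ℝ] ℝ :=
    (EuclideanSpace.proj i : Space (m + 1) →L[ℝ] ℝ) ∘L
      (fderiv ℝ v (L y)) ∘L (L : (Fin (m + 1) → ℝ) →L[ℝ] Space (m + 1))
  have hdiv (y : Fin (m + 1) → ℝ) :
      divergence v (L y) = ∑ i, f' i y (Pi.single i 1) := by
    simp only [divergence, f']
    rfl
  have hder (y : Fin (m + 1) → ℝ) (i : Fin (m + 1)) :
      HasFDerivAt (fun y => v (L y) i) (f' i y) y := by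
    have h1 : HasFDerivAt v (fderiv ℝ v (L y)) (L y) :=
      (hv.contDiff.differentiable one_ne_zero (L y)).hasFDerivAt
    exact (EuclideanSpace.proj i : Space (m + 1) →L[ℝ] ℝ).hasFDerivAt.comp y
      (h1.comp y L.hasFDerivAt)
  have hcd : Continuous fun y => divergence v (L y) := hv.continuous_divergence.comp L.continuous
  have hthm := integral_divergence_of_hasFDerivAt_off_countable' a b hab
    (fun i y => v (L y) i) f' ∅ Set.countable_empty
    (fun i y _ => (hder y i).continuousAt.continuousWithinAt)
    (fun y _ i => hder y i)
    (by
      simp only [← hdiv]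
      exact hcd.continuousOn.integrableOn_compact isCompact_Icc)
  have hface (i : Fin (m + 1)) (c : ℝ) :
      |∫ y in Set.Icc (a ∘ i.succAbove) (b ∘ i.succAbove), v (L (i.insertNth c y)) i| ≤
        (volume (Set.Icc (a ∘ i.succAbove) (b ∘ i.succAbove))).toReal := by
    have := norm_setIntegral_le_of_norm_le_const (μ := volume)
      (s := Set.Icc (a ∘ i.succAbove) (b ∘ i.succAbove))
      (f := fun y => v (L (i.insertNth c y)) i) (C := 1)
      isCompact_Icc.measure_lt_top
      (fun y _ => (PiLp.norm_apply_le _ i).trans (hv.norm_le_one _))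
    simpa [Measure.real] using this
  calc ∫ x, (box a b).indicator (fun _ => (1 : ℝ)) x * divergence v x
      = ∫ x in box a b, divergence v x := by
        rw [← integral_indicator (isCompact_box a b).measurableSet]
        congr 1
        ext x
        by_cases hx : x ∈ box a b <;> simp [hx]
    _ = ∫ y in Set.Icc a b, divergence v (L y) := by
        rw [← hpre, hmp.setIntegral_preimage_emb hme]
    _ = _ := by
        simp only [hdiv]
        exact hthm
    _ ≤ B := by
        refine Finset.sum_le_sum fun i _ => ?_
        have h1 := abs_le.1 (hface i (b i))
        have h2 := abs_le.1 (hface i (a i))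
        linarith

theorem memBV_box {a b : Fin d → ℝ} (hab : a ≤ b) (h : box a b ⊆ unitCube d) :
    MemBV ((box a b).indicator fun _ => (1 : ℝ)) :=
  ⟨(integrable_indicator_iff (isCompact_box a b).measurableSet).2
      (integrableOn_const (isCompact_box a b).measure_lt_top.ne),
    variation_box_lt_top hab,
    Eventually.of_forall fun _ hx => Set.indicator_of_notMem (fun hx' => hx (h hx')) _⟩

end box

/-- Dyadic cubes of generation `n` in `[0, 1]ᵈ`. -/
def IsDyadicCube {d : ℕ} (n : ℕ) (Q : Set (Space d)) : Prop :=
  ∃ c : Fin d → ℕ, (∀ i, c i < 2 ^ n) ∧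
    Q = box (fun i => (c i : ℝ) / 2 ^ n) (fun i => ((c i : ℝ) + 1) / 2 ^ n)

theorem isDyadicCube_unitCube (d : ℕ) : IsDyadicCube 0 (unitCube d) :=
  ⟨fun _ => 0, by simp, by simp [unitCube, box]⟩

theorem IsDyadicCube.measurableSet {d n : ℕ} {Q : Set (Space d)} (h : IsDyadicCube n Q) :
    MeasurableSet Q := by
  obtain ⟨c, -, rfl⟩ := h
  exact (isCompact_box _ _).measurableSet

theorem IsDyadicCube.memBV {d n : ℕ} {Q : Set (Space d)} (h : IsDyadicCube n Q) :
    MemBV (Q.indicator fun _ => (1 : ℝ)) := by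
  obtain ⟨c, hc, rfl⟩ := h
  refine memBV_box (fun i => ?_) fun x hx i => ⟨le_trans (by positivity) (hx i).1,
    (hx i).2.trans ?_⟩
  · dsimp only
    gcongr
    linarith
  · rw [div_le_one (by positivity)]
    exact_mod_cast hc i

/-- A numbering `K_{n,k}`, `0 ≤ k < 2^{nd}`, of the dyadic cubes of each generation `n` such that
`K_{n+1, 2^d k}, …, K_{n+1, 2^d k + 2^d - 1}` are the `2^d` subcubes of `K_{n,k}` of generation
`n + 1`. (The values for `k ≥ 2^{nd}` are irrelevant.) -/
structure DyadicNumbering (d : ℕ) where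
  cube : ℕ → ℕ → Set (Space d)
  bijOn : ∀ n, Set.BijOn (cube n) (Set.Iio (2 ^ (n * d))) {Q | IsDyadicCube n Q}
  image_children : ∀ n, ∀ k < 2 ^ (n * d),
    (fun l => cube (n + 1) (2 ^ d * k + l)) '' Set.Iio (2 ^ d) =
      {Q | IsDyadicCube (n + 1) Q ∧ Q ⊆ cube n k}

/-- The matrix `A_d` of order `2^d`: `A_0 = (1)` and `A_{d+1} = [A_d, A_d; A_d, -A_d]`. -/
def haarMatrix : (d : ℕ) → Matrix (Fin (2 ^ d)) (Fin (2 ^ d)) ℝ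
  | 0 => 1
  | d + 1 =>
    let e : Fin (2 ^ d) ⊕ Fin (2 ^ d) ≃ Fin (2 ^ (d + 1)) :=
      finSumFinEquiv.trans (finCongr (by rw [pow_succ, mul_two]))
    Matrix.reindex e e
      (Matrix.fromBlocks (haarMatrix d) (haarMatrix d) (haarMatrix d) (-haarMatrix d))

section haar

variable {d : ℕ} (K : DyadicNumbering d)

/-- The Haar function `g_{n,k,r}`, extended by `0` outside `[0, 1]ᵈ`. -/
def haar (n k : ℕ) (r : Fin (2 ^ d)) (x : Space d) : ℝ :=
  2 ^ ((n * d : ℝ) / 2) * ∑ l : Fin (2 ^ d),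
    haarMatrix d r l * (K.cube (n + 1) (2 ^ d * k + l)).indicator (fun _ => 1) x

/-- The generation number of the `j`-th Haar function, `j ≥ 1`. There are `2^{nd}` Haar functions
of generation less than `n` (the constant `g_{-1}` included), so that generation `n` occupies the
positions `2^{nd} ≤ j < 2^{(n+1)d}`. -/
def haarGen (d j : ℕ) : ℕ := Nat.log (2 ^ d) j

/-- The cube number of the `j`-th Haar function, `j ≥ 1`. -/
def haarCube (d j : ℕ) : ℕ := (j - 2 ^ (haarGen d j * d)) / (2 ^ d - 1)

/-- The type number of the `j`-th Haar function, `j ≥ 1`. -/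
def haarType (d j : ℕ) [NeZero d] : Fin (2 ^ d) :=
  ⟨(j - 2 ^ (haarGen d j * d)) % (2 ^ d - 1) + 1, by
    have h : 1 < 2 ^ d := Nat.one_lt_two_pow (NeZero.ne d)
    have := Nat.mod_lt (j - 2 ^ (haarGen d j * d)) (by omega : 0 < 2 ^ d - 1)
    omega⟩

theorem isDyadicCube_child {n k : ℕ} (hk : k < 2 ^ (n * d)) (l : Fin (2 ^ d)) :
    IsDyadicCube (n + 1) (K.cube (n + 1) (2 ^ d * k + l)) :=
  ((K.image_children n k hk).subset ⟨l, l.2, rfl⟩).1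

variable [NeZero d]

/-- The Haar functions `g_{-1}, g_{0,0,1}, g_{0,0,2}, …`, with the indices `(n, k, r)`,
`0 ≤ k < 2^{nd}`, `1 ≤ r < 2^d`, in lexicographic order. -/
def haarSeq : ℕ → Space d → ℝ
  | 0 => (unitCube d).indicator fun _ => 1
  | j + 1 => haar K (haarGen d (j + 1)) (haarCube d (j + 1)) (haarType d (j + 1))

/-- In the sequence `haarSeq`, the function `g_{n,k,r}` has position
`2^{nd} + k (2^d - 1) + (r - 1)`. -/
theorem haarSeq_index (n k : ℕ) (hk : k < 2 ^ (n * d)) (r : Fin (2 ^ d)) (hr : 1 ≤ (r : ℕ)) :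
    haarSeq K (2 ^ (n * d) + k * (2 ^ d - 1) + (r - 1)) = haar K n k r := by
  have h1 : 1 < 2 ^ d := Nat.one_lt_two_pow (NeZero.ne d)
  have hpos : 0 < 2 ^ (n * d) := by positivity
  have hm : k * (2 ^ d - 1) + (r - 1) < 2 ^ (n * d) * (2 ^ d - 1) := by
    have := r.2
    calc k * (2 ^ d - 1) + (r - 1) < k * (2 ^ d - 1) + (2 ^ d - 1) := by omega
      _ = (k + 1) * (2 ^ d - 1) := by ring
      _ ≤ _ := Nat.mul_le_mul_right _ hk
  have hub : 2 ^ (n * d) * (2 ^ d - 1) + 2 ^ (n * d) = 2 ^ ((n + 1) * d) := by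
    rw [← Nat.mul_succ, Nat.succ_eq_add_one, Nat.sub_add_cancel h1.le, ← pow_add]
    ring
  obtain ⟨j, hj⟩ : ∃ j, 2 ^ (n * d) + k * (2 ^ d - 1) + (r - 1) = j + 1 :=
    ⟨2 ^ (n * d) + k * (2 ^ d - 1) + (r - 1) - 1, by omega⟩
  have hgen : haarGen d (j + 1) = n := by
    unfold haarGen
    rw [Nat.log_eq_iff (Or.inr ⟨h1, by omega⟩), ← pow_mul, ← pow_mul, mul_comm d n,
      mul_comm d (n + 1)]
    omega
  have hsub : j + 1 - 2 ^ (n * d) = (r - 1) + (2 ^ d - 1) * k := by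
    rw [← hj, mul_comm k]
    omega
  have hr' : (r : ℕ) - 1 < 2 ^ d - 1 := by have := r.2; omega
  have hcube : haarCube d (j + 1) = k := by
    unfold haarCube
    rw [hgen, hsub, Nat.add_mul_div_left _ _ (by omega), Nat.div_eq_of_lt hr', zero_add]
  have htype : haarType d (j + 1) = r := by
    apply Fin.ext
    simp only [haarType]
    rw [hgen, hsub, Nat.add_mul_mod_self_left, Nat.mod_eq_of_lt hr']
    omega
  rw [hj, haarSeq, hgen, hcube, htype]

theorem haarCube_lt (j : ℕ) : haarCube d (j + 1) < 2 ^ (haarGen d (j + 1) * d) := by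
  have h1 : 1 < 2 ^ d := Nat.one_lt_two_pow (NeZero.ne d)
  have hlt := Nat.lt_pow_succ_log_self h1 (j + 1)
  unfold haarCube
  rw [Nat.div_lt_iff_lt_mul (by omega)]
  change j + 1 < (2 ^ d) ^ (haarGen d (j + 1) + 1) at hlt
  set n := haarGen d (j + 1)
  have hub : 2 ^ (n * d) * (2 ^ d - 1) + 2 ^ (n * d) = (2 ^ d) ^ (n + 1) := by
    rw [← Nat.mul_succ, Nat.succ_eq_add_one, Nat.sub_add_cancel h1.le, ← pow_add, ← pow_mul]
    ring
  have : 0 < 2 ^ (n * d) * (2 ^ d - 1) := Nat.mul_pos (by positivity) (by omega)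
  omega

theorem memBV_haarSeq (j : ℕ) : MemBV (haarSeq K j) := by
  cases j with
  | zero => exact (isDyadicCube_unitCube d).memBV
  | succ j =>
    exact (MemBV.sum _ fun l _ =>
      (isDyadicCube_child K (haarCube_lt j) l).memBV.const_mul _).const_mul _

theorem memLp_haarSeq (j : ℕ) : MemLp (haarSeq K j) d (cubeMeasure d) := by
  have : IsFiniteMeasure (cubeMeasure d) :=
    ⟨by simpa using (isCompact_unitCube d).measure_lt_top⟩
  have h (n : ℕ) (Q : Set (Space d)) (hQ : IsDyadicCube n Q) :
      MemLp (Q.indicator fun _ => (1 : ℝ)) d (cubeMeasure d) :=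
    (memLp_const 1).indicator hQ.measurableSet
  cases j with
  | zero => exact h 0 _ (isDyadicCube_unitCube d)
  | succ j =>
    exact (memLp_finsetSum _ fun l _ =>
      (h _ _ (isDyadicCube_child K (haarCube_lt j) l)).const_mul _).const_mul _

/-- The Haar functions as elements of `BV([0, 1]ᵈ)`. -/
def haarBV (j : ℕ) : BV d := BV.mk (haarSeq K j) (memBV_haarSeq K j)

/-- The Haar functions as elements of `L^d([0, 1]ᵈ)`. -/
def haarLp (j : ℕ) : Lp ℝ d (cubeMeasure d) := (memLp_haarSeq K j).toLp (haarSeq K j)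

/-- The sequence `T_{g_{-1}}, T_{g_{0,0,1}}, T_{g_{0,0,2}}, …` in `SCH([0, 1]ᵈ)`. -/
def haarCharge (j : ℕ) : SCH d := strongCharge (haarLp K j)

end haar

end

end StrongCharge

open StrongCharge

/-! Let `S_N u = ∑_{j<N} (∫ u g_j) g_j` be the partial sums of the Haar series of `u ∈ BV`. The
`N`-th partial sum of the series of a functional `α` sends `u` to `α (S_N u)`: it is the transpose
of `S_N` applied to `α` (`haarProj_apply`). So it suffices to bound the operators `S_N` on BV
uniformly in `N` (`exists_norm_partialSum_le`); convergence of `S_N u` in BV is not needed.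
Orthonormality of the Haar functions (`integral_haarSeq_mul`) makes the transposes eventually the
identity on each finite combination of the `T_g`. These combinations are dense in SCH, because the
Haar functions span a dense subspace of `L^d` and `T` is continuous. A uniform bound and convergence
on a dense subspace give convergence everywhere, and applying the evaluations at Haar functions to a
convergent series gives uniqueness.

The uniform bound rests on `‖u(· + t) - u‖₁ ≤ d |t| ‖Du‖`. With `t` large enough to move the cube
off itself, this is a Poincaré inequality, so that only variations need to be estimated. With `t` of
order `2⁻ⁿ`, it controls the differences between integrals of `u` over nearby dyadic cubes of
generation `n`.

For `N = 2^{nd}`, `S_N u` is the function of averages over dyadic cubes of generation `n`. Its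
variation is at most the sum over faces of jump times area. The jumps sum to `O(2^{nd} 2⁻ⁿ ‖Du‖)`,
the area of a face is `2^{-n(d-1)}`, and the powers of `2` cancel. For other `N` an incomplete
generation remains, and there the triangle inequality suffices: the coefficients sum to `O(2^{nd/2}
2⁻ⁿ ‖Du‖)` in absolute value, each function has BV norm `O(2^{nd/2} 2^{-n(d-1)})`, and the product
is `O(‖Du‖)`. -/

namespace StrongCharge

/-! ### Translation estimate and Poincaré inequality in BV -/

section translation

variable {d : ℕ} {u w : Space d → ℝ}

/-- Write the increment as the integral of the derivative along the segment from `x` to `x + t` and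
exchange the integrals; by translation invariance the integral over `x` does not depend on the
position on the segment. -/
theorem lintegral_translate_sub_le_fderiv (hw : ContDiff ℝ 1 w) (t : Space d) :
    ∫⁻ x, ‖w (x + t) - w x‖ₑ ≤ ‖t‖ₑ * eLpNorm (fderiv ℝ w) 1 volume := by
  have hcont : Continuous (fderiv ℝ w) := hw.continuous_fderiv one_ne_zero
  have hpt (x : Space d) : ‖w (x + t) - w x‖ₑ ≤
      ∫⁻ s in Set.Ioc (0 : ℝ) 1, ‖fderiv ℝ w (x + s • t) t‖ₑ := by
    have hder (s : ℝ) : HasDerivAt (fun s : ℝ => w (x + s • t)) (fderiv ℝ w (x + s • t) t) s := by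
      have h1 : HasDerivAt (fun s : ℝ => x + s • t) t s := by
        simpa using ((hasDerivAt_id s).smul_const t).const_add x
      exact ((hw.differentiable one_ne_zero _).hasFDerivAt).comp_hasDerivAt s h1
    have hc : Continuous fun s : ℝ => fderiv ℝ w (x + s • t) t := by fun_prop
    have h2 := intervalIntegral.integral_eq_sub_of_hasDerivAt (a := 0) (b := 1)
      (fun s _ => hder s) (hc.intervalIntegrable _ _)
    simp only [one_smul, zero_smul, add_zero] at h2
    rw [← h2, intervalIntegral.integral_of_le zero_le_one]
    exact enorm_integral_le_lintegral_enorm _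
  have hm : Measurable (Function.uncurry fun (x : Space d) (s : ℝ) =>
      ‖fderiv ℝ w (x + s • t) t‖ₑ) := by
    have : Continuous fun p : Space d × ℝ => fderiv ℝ w (p.1 + p.2 • t) t := by fun_prop
    exact this.measurable.enorm
  calc ∫⁻ x, ‖w (x + t) - w x‖ₑ
      ≤ ∫⁻ x, ∫⁻ s in Set.Ioc (0 : ℝ) 1, ‖fderiv ℝ w (x + s • t) t‖ₑ := lintegral_mono hpt
    _ = ∫⁻ s in Set.Ioc (0 : ℝ) 1, ∫⁻ x, ‖fderiv ℝ w (x + s • t) t‖ₑ :=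
        lintegral_lintegral_swap hm.aemeasurable
    _ = ∫⁻ s in Set.Ioc (0 : ℝ) 1, ∫⁻ x, ‖fderiv ℝ w x t‖ₑ := by
        refine lintegral_congr fun s => ?_
        exact lintegral_add_right_eq_self (fun x => ‖fderiv ℝ w x t‖ₑ) (s • t)
    _ = ∫⁻ x, ‖fderiv ℝ w x t‖ₑ := by simp
    _ ≤ ∫⁻ x, ‖t‖ₑ * ‖fderiv ℝ w x‖ₑ := by
        refine lintegral_mono fun x => ?_
        rw [mul_comm]
        exact ContinuousLinearMap.le_opENorm _ _
    _ = _ := by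
        rw [lintegral_const_mul _ hcont.measurable.enorm, eLpNorm_one_eq_lintegral_enorm]

/-- Translations are Lipschitz in `L¹` on functions of bounded variation. -/
theorem MemBV.lintegral_translate_sub_le (hu : MemBV u) (t : Space d) :
    ∫⁻ x, ‖u (x + t) - u x‖ₑ ≤ ‖t‖ₑ * (d * variation u) := by
  -- Cutting `u` off outside the unit cube does not change its class, and makes the mollifications
  -- compactly supported, as `eLpNorm_fderiv_le` requires.
  wlog hsupp : HasCompactSupport u generalizing u
  · have huu : u =ᵐ[volume] (unitCube d).indicator u := by
      filter_upwards [hu.ae_eq_zero] with x hx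
      by_cases h : x ∈ unitCube d
      · simp [h]
      · simp [h, hx h]
    have hc : HasCompactSupport ((unitCube d).indicator u) :=
      HasCompactSupport.of_support_subset_isCompact (isCompact_unitCube d)
        Set.support_indicator_subset
    have := this (hu.congr huu) hc
    rw [variation_congr huu]
    refine le_trans (le_of_eq (lintegral_congr_ae ?_)) this
    have h2 := (measurePreserving_add_right volume t).quasiMeasurePreserving.ae_eq_comp huu
    filter_upwards [huu, h2] with x h1 h2
    simp only [Function.comp_apply] at h2
    rw [h1, h2]
  let φ (n : ℕ) : ContDiffBump (0 : Space d) :=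
    ⟨1 / (n + 1), 2 * (1 / (n + 1)), by positivity, by
      have : (0 : ℝ) < 1 / (n + 1) := by positivity
      linarith⟩
  let W (n : ℕ) : Space d → ℝ :=
    convolution ((φ n).normed volume) u (ContinuousLinearMap.lsmul ℝ ℝ) volume
  have hWs (n : ℕ) : ContDiff ℝ 2 (W n) :=
    (φ n).hasCompactSupport_normed.contDiff_convolution_left (n := 2) _
      (φ n).contDiff_normed hu.integrable.locallyIntegrable
  have hWc (n : ℕ) : HasCompactSupport (W n) :=
    (φ n).hasCompactSupport_normed.convolution _ hsupp
  have hlim : ∀ᵐ x, Tendsto (fun n => W n x) atTop (𝓝 (u x)) := by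
    refine ContDiffBump.ae_convolution_tendsto_right_of_locallyIntegrable (K := 2) ?_ ?_
      hu.integrable.locallyIntegrable
    · have := (tendsto_one_div_add_atTop_nhds_zero_nat (𝕜 := ℝ)).const_mul 2
      rw [mul_zero] at this
      exact this
    · exact Eventually.of_forall fun n => le_rfl
  have hlim' : ∀ᵐ x, Tendsto (fun n => W n (x + t) - W n x) atTop (𝓝 (u (x + t) - u x)) := by
    filter_upwards [hlim,
      (measurePreserving_add_right volume t).quasiMeasurePreserving.ae hlim] with x h1 h2
    exact h2.sub h1
  rw [← eLpNorm_one_eq_lintegral_enorm (f := fun x => u (x + t) - u x)]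
  -- Fatou's lemma. The bound for the mollifications does not depend on `n`, since mollifying does
  -- not increase the variation; hence a single index `n` is enough to bound the lower limit.
  refine (Lp.eLpNorm_lim_le_liminf_eLpNorm (f := fun n x => W n (x + t) - W n x)
    (fun n => ?_) (fun x => u (x + t) - u x) hlim').trans ?_
  · have := (hWs n).continuous
    exact (by fun_prop : Continuous fun x => W n (x + t) - W n x).aestronglyMeasurable
  refine liminf_le_of_le (by isBoundedDefault) fun b hb => ?_
  obtain ⟨n, hn⟩ := hb.exists
  refine hn.trans ?_
  rw [eLpNorm_one_eq_lintegral_enorm]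
  refine (lintegral_translate_sub_le_fderiv ((hWs n).of_le (by norm_num)) t).trans ?_
  have hle := variation_convolution_le (φ n) hu.integrable hu.variation_lt_top
  gcongr
  exact (eLpNorm_fderiv_le (hWs n) (hWc n) (hle.trans_lt hu.variation_lt_top)).trans
    (mul_le_mul_right hle _)

theorem integrable_translate_sub (hu : Integrable u) (t : Space d) :
    Integrable fun x => u (x + t) - u x :=
  (hu.comp_add_right t).sub hu

theorem MemBV.integral_abs_translate_sub_le (hu : MemBV u) (t : Space d) :
    ∫ x, |u (x + t) - u x| ≤ d * ‖t‖ * (variation u).toReal := by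
  have h := hu.lintegral_translate_sub_le t
  have hi := integrable_translate_sub hu.integrable t
  rw [← ofReal_integral_norm_eq_lintegral_enorm hi] at h
  have hfin : ‖t‖ₑ * (d * variation u) ≠ ∞ :=
    ENNReal.mul_ne_top enorm_ne_top (ENNReal.mul_ne_top (ENNReal.natCast_ne_top d)
      hu.variation_lt_top.ne)
  have h2 := (ENNReal.ofReal_le_iff_le_toReal hfin).1 h
  simp only [ENNReal.toReal_mul, ENNReal.toReal_natCast, toReal_enorm, Real.norm_eq_abs] at h2
  linarith

/-- The Poincaré inequality on `BV([0, 1]ᵈ)`. -/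
theorem MemBV.integral_abs_le [NeZero d] (hu : MemBV u) :
    ∫ x, |u x| ≤ 2 * d * (variation u).toReal := by
  -- A shift of length `2` in one direction moves the cube off itself, so `u (x + t) = 0` wherever
  -- `u x` can be nonzero.
  set t : Space d := EuclideanSpace.single 0 2 with ht
  have hnt : ‖t‖ = 2 := by simp [ht]
  have h := hu.integral_abs_translate_sub_le t
  rw [hnt] at h
  refine le_trans (integral_mono_ae hu.integrable.abs
    (integrable_translate_sub hu.integrable t).abs ?_) (h.trans (by linarith))
  filter_upwards [hu.ae_eq_zero,
    (measurePreserving_add_right volume t).quasiMeasurePreserving.ae hu.ae_eq_zero] with x h1 h2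
  by_cases hx : x ∈ unitCube d
  · have : x + t ∉ unitCube d := fun hxt => by
      have h3 := (hx 0).1
      have h4 := (hxt 0).2
      simp [ht] at h4
      linarith
    simp [h2 this]
  · simp [h1 hx]

end translation

/-! ### Half-open dyadic cubes, fluxes, and averages over cubes -/

section cell

variable {d : ℕ} {u f : Space d → ℝ}

/-- The index of the half-open dyadic cube of side `2⁻ⁿ` that contains `x`. -/
noncomputable def cellIndex (n : ℕ) (x : Space d) : Fin d → ℤ := fun i => ⌊2 ^ n * x i⌋

/-- The half-open dyadic cube of side `2⁻ⁿ` with index `c`. -/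
def cell (n : ℕ) (c : Fin d → ℤ) : Set (Space d) := {x | cellIndex n x = c}

theorem mem_cell {n : ℕ} {c : Fin d → ℤ} {x : Space d} : x ∈ cell n c ↔ cellIndex n x = c :=
  Iff.rfl

theorem mem_cell_iff {n : ℕ} {c : Fin d → ℤ} {x : Space d} :
    x ∈ cell n c ↔ ∀ i, (c i : ℝ) / 2 ^ n ≤ x i ∧ x i < ((c i : ℝ) + 1) / 2 ^ n := by
  have h2 : (0 : ℝ) < 2 ^ n := by positivity
  simp only [mem_cell, funext_iff, cellIndex, Int.floor_eq_iff, div_le_iff₀ h2, lt_div_iff₀ h2,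
    mul_comm]

theorem cell_eq_preimage (n : ℕ) (c : Fin d → ℤ) :
    cell n c = WithLp.ofLp ⁻¹' (Set.univ.pi fun i =>
      Set.Ico ((c i : ℝ) / 2 ^ n) (((c i : ℝ) + 1) / 2 ^ n)) := by
  ext x
  simp [mem_cell_iff, Set.mem_Ico]

theorem measurableSet_cell (n : ℕ) (c : Fin d → ℤ) : MeasurableSet (cell n c) := by
  rw [cell_eq_preimage]
  exact (PiLp.volume_preserving_ofLp (Fin d)).measurable
    (MeasurableSet.univ_pi fun i => measurableSet_Ico)

/-- Closed dyadic cubes overlap along faces. Up to a null set they may be replaced by the fibres of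
`cellIndex`, which partition the space exactly. -/
theorem cell_ae_eq_box (n : ℕ) (c : Fin d → ℤ) :
    cell n c =ᵐ[volume] box (fun i => (c i : ℝ) / 2 ^ n) (fun i => ((c i : ℝ) + 1) / 2 ^ n) := by
  rw [cell_eq_preimage, box_eq]
  exact (PiLp.volume_preserving_ofLp (Fin d)).quasiMeasurePreserving.preimage_ae_eq
    Measure.univ_pi_Ico_ae_eq_Icc

theorem volume_real_cell (n : ℕ) (c : Fin d → ℤ) :
    volume.real (cell n c) = (((2 : ℝ) ^ n)⁻¹) ^ d := by
  rw [cell_eq_preimage, measureReal_def,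
    (PiLp.volume_preserving_ofLp (Fin d)).measure_preimage
      (MeasurableSet.univ_pi fun i => measurableSet_Ico).nullMeasurableSet, volume_pi_pi]
  simp only [Real.volume_Ico]
  have : ∀ i : Fin d, ((c i : ℝ) + 1) / 2 ^ n - (c i : ℝ) / 2 ^ n = ((2 : ℝ) ^ n)⁻¹ := fun i => by
    ring
  simp only [this, Finset.prod_const, Finset.card_univ, Fintype.card_fin, ENNReal.toReal_pow]
  rw [ENNReal.toReal_ofReal (by positivity)]

theorem disjoint_cell {n : ℕ} {c c' : Fin d → ℤ} (h : c ≠ c') : Disjoint (cell n c) (cell n c') :=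
  Set.disjoint_left.2 fun _ hx hx' => h (hx.symm.trans hx')

/-- The vector `2⁻ⁿ e`. -/
noncomputable def shift (n : ℕ) (e : Fin d → ℤ) : Space d :=
  WithLp.toLp 2 fun i => (e i : ℝ) / 2 ^ n

theorem cellIndex_add_shift (n : ℕ) (e : Fin d → ℤ) (x : Space d) :
    cellIndex n (x + shift n e) = cellIndex n x + e := by
  funext i
  have h2 : (2 : ℝ) ^ n ≠ 0 := by positivity
  simp only [cellIndex, shift, PiLp.add_apply, Pi.add_apply, mul_add, mul_div_cancel₀ _ h2,
    Int.floor_add_intCast]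

theorem setIntegral_cell_add (n : ℕ) (c e : Fin d → ℤ) (u : Space d → ℝ) :
    ∫ x in cell n (c + e), u x = ∫ x in cell n c, u (x + shift n e) := by
  rw [← (measurePreserving_add_right volume (shift n e)).setIntegral_preimage_emb
    (measurableEmbedding_addRight _) u]
  congr 2
  ext x
  simp [mem_cell, cellIndex_add_shift]

theorem sum_abs_setIntegral_cell_le (n : ℕ) (s : Finset (Fin d → ℤ)) (hf : Integrable f) :
    ∑ c ∈ s, |∫ x in cell n c, f x| ≤ ∫ x, |f x| := by
  calc ∑ c ∈ s, |∫ x in cell n c, f x| ≤ ∑ c ∈ s, ∫ x in cell n c, |f x| :=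
        Finset.sum_le_sum fun c _ => abs_integral_le_integral_abs
    _ = ∫ x in ⋃ c ∈ s, cell n c, |f x| := by
        rw [integral_biUnion_finset s (fun c _ => measurableSet_cell n c)
          (fun c _ c' _ h => disjoint_cell h) (fun c _ => hf.abs.integrableOn)]
    _ ≤ ∫ x, |f x| :=
        setIntegral_le_integral hf.abs (Eventually.of_forall fun x => abs_nonneg _)

/-- The integrals over two cells that differ by `e` are compared by translation. As the cells are
disjoint, all the differences together are bounded by one `L¹` norm of `u(· + t) - u`, with `t` of
order `2⁻ⁿ`. All gains of a factor `2⁻ⁿ` come from here. -/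
theorem sum_abs_setIntegral_cell_sub_le (n : ℕ) (s : Finset (Fin d → ℤ)) (e : Fin d → ℤ)
    (hu : MemBV u) :
    ∑ c ∈ s, |(∫ x in cell n (c + e), u x) - ∫ x in cell n c, u x| ≤
      d * ‖(shift n e : Space d)‖ * (variation u).toReal := by
  refine le_trans (le_of_eq (Finset.sum_congr rfl fun c _ => ?_))
    ((sum_abs_setIntegral_cell_le n s (integrable_translate_sub hu.integrable (shift n e))).trans
      (hu.integral_abs_translate_sub_le _))
  rw [setIntegral_cell_add, integral_sub (hu.integrable.comp_add_right _).integrableOn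
    hu.integrable.integrableOn]

theorem norm_shift (n : ℕ) (e : Fin d → ℤ) :
    ‖(shift n e : Space d)‖ = ((2 : ℝ) ^ n)⁻¹ * ‖(shift 0 e : Space d)‖ := by
  have : (shift n e : Space d) = ((2 : ℝ) ^ n)⁻¹ • shift 0 e := by
    ext i
    simp [shift]
    ring
  rw [this, norm_smul, Real.norm_of_nonneg (by positivity)]

theorem norm_shift_zero_single (i : Fin d) : ‖(shift 0 (Pi.single i (-1)) : Space d)‖ = 1 := by
  have : (shift 0 (Pi.single i (-1)) : Space d) = EuclideanSpace.single i (-1) := by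
    ext j
    by_cases h : j = i
    · subst h; simp [shift]
    · simp [shift, h]
  rw [this]
  simp

/-- The divergence theorem on dyadic cubes: `F i c` is the flux through the lower face of the
cube of index `c` that is orthogonal to the direction `i`. -/
theorem IsTestField.exists_flux [NeZero d] {v : Space d → Space d} (hv : IsTestField v) (n : ℕ) :
    ∃ F : Fin d → (Fin d → ℤ) → ℝ, (∀ i c, |F i c| ≤ (((2 : ℝ) ^ n)⁻¹) ^ (d - 1)) ∧
      ∀ c, ∫ x in cell n c, divergence v x = ∑ i, (F i (c + Pi.single i 1) - F i c) := by
  obtain ⟨m, rfl⟩ : ∃ m, d = m + 1 := ⟨d - 1, by have := NeZero.pos d; omega⟩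
  let lo (c : Fin (m + 1) → ℤ) : Fin (m + 1) → ℝ := fun i => (c i : ℝ) / 2 ^ n
  let hi (c : Fin (m + 1) → ℤ) : Fin (m + 1) → ℝ := fun i => ((c i : ℝ) + 1) / 2 ^ n
  have hlohi (c : Fin (m + 1) → ℤ) : lo c ≤ hi c := fun i => by
    simp only [lo, hi]
    gcongr
    linarith
  let L := (PiLp.continuousLinearEquiv 2 ℝ (fun _ : Fin (m + 1) => ℝ)).symm
  have hL (y : Fin (m + 1) → ℝ) : L y = WithLp.toLp 2 y := rfl
  have hmp : MeasurePreserving L volume volume := PiLp.volume_preserving_toLp (Fin (m + 1))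
  have hme : MeasurableEmbedding L := L.toHomeomorph.measurableEmbedding
  have hpre (a b : Fin (m + 1) → ℝ) : L ⁻¹' box a b = Set.Icc a b := by
    ext y
    simp [box, hL, Set.mem_Icc, Pi.le_def, forall_and]
  let f' (i : Fin (m + 1)) (y : Fin (m + 1) → ℝ) : (Fin (m + 1) → ℝ) →L[ℝ] ℝ :=
    (EuclideanSpace.proj i : Space (m + 1) →L[ℝ] ℝ) ∘L
      (fderiv ℝ v (L y)) ∘L (L : (Fin (m + 1) → ℝ) →L[ℝ] Space (m + 1))
  have hdiv (y : Fin (m + 1) → ℝ) :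
      divergence v (L y) = ∑ i, f' i y (Pi.single i 1) := by
    simp only [divergence, f']
    rfl
  have hder (y : Fin (m + 1) → ℝ) (i : Fin (m + 1)) :
      HasFDerivAt (fun y => v (L y) i) (f' i y) y := by
    have h1 : HasFDerivAt v (fderiv ℝ v (L y)) (L y) :=
      (hv.contDiff.differentiable one_ne_zero (L y)).hasFDerivAt
    exact (EuclideanSpace.proj i : Space (m + 1) →L[ℝ] ℝ).hasFDerivAt.comp y
      (h1.comp y L.hasFDerivAt)
  have hcd : Continuous fun y => divergence v (L y) := hv.continuous_divergence.comp L.continuous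
  refine ⟨fun i c => ∫ y in Set.Icc (lo c ∘ i.succAbove) (hi c ∘ i.succAbove),
    v (L (i.insertNth (lo c i) y)) i, fun i c => ?_, fun c => ?_⟩
  · have := norm_setIntegral_le_of_norm_le_const (μ := volume)
      (s := Set.Icc (lo c ∘ i.succAbove) (hi c ∘ i.succAbove))
      (f := fun y => v (L (i.insertNth (lo c i) y)) i) (C := 1)
      isCompact_Icc.measure_lt_top
      (fun y _ => (PiLp.norm_apply_le _ i).trans (hv.norm_le_one _))
    refine (this.trans (le_of_eq ?_))
    have hd (j : Fin m) : hi c (i.succAbove j) - lo c (i.succAbove j) = ((2 : ℝ) ^ n)⁻¹ := by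
      simp only [hi, lo]
      ring
    rw [one_mul, measureReal_def, Real.volume_Icc_pi]
    simp only [Function.comp_apply, hd, Finset.prod_const, Finset.card_univ, Fintype.card_fin,
      ENNReal.toReal_pow, add_tsub_cancel_right]
    rw [ENNReal.toReal_ofReal (by positivity)]
  · have hthm := integral_divergence_of_hasFDerivAt_off_countable' (lo c) (hi c) (hlohi c)
      (fun i y => v (L y) i) f' ∅ Set.countable_empty
      (fun i y _ => (hder y i).continuousAt.continuousWithinAt)
      (fun y _ i => hder y i)
      (by
        simp only [← hdiv]
        exact hcd.continuousOn.integrableOn_compact isCompact_Icc)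
    rw [setIntegral_congr_set (cell_ae_eq_box n c), ← hmp.setIntegral_preimage_emb hme, hpre]
    simp only [hdiv]
    refine hthm.trans (Finset.sum_congr rfl fun i _ => ?_)
    -- The upper face of a cube in direction `i` is the lower face of its neighbour, so that both
    -- fluxes are values of the same function `F i`. This makes summation by parts possible.
    have h1 : lo (c + Pi.single i 1) ∘ i.succAbove = lo c ∘ i.succAbove := by
      funext j
      simp [lo, Fin.succAbove_ne]
    have h2 : hi (c + Pi.single i 1) ∘ i.succAbove = hi c ∘ i.succAbove := by
      funext j
      simp [hi, Fin.succAbove_ne]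
    have h3 : lo (c + Pi.single i 1) i = hi c i := by simp [lo, hi]
    rw [h1, h2, h3]

theorem variation_le_ofReal {B : ℝ}
    (h : ∀ v, IsTestField v → ∫ x, u x * divergence v x ≤ B) : variation u ≤ ENNReal.ofReal B :=
  iSup₂_le fun v hv => ENNReal.ofReal_le_ofReal (h v hv)

/-- The cube has `2 d` faces, and the flux through each is at most its area. -/
theorem IsTestField.abs_setIntegral_cell_divergence_le [NeZero d] {v : Space d → Space d}
    (hv : IsTestField v) (n : ℕ) (c : Fin d → ℤ) :
    |∫ x in cell n c, divergence v x| ≤ 2 * d * (((2 : ℝ) ^ n)⁻¹) ^ (d - 1) := by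
  obtain ⟨F, hF, h⟩ := hv.exists_flux n
  rw [h c]
  calc |∑ i, (F i (c + Pi.single i 1) - F i c)|
      ≤ ∑ _i : Fin d, 2 * (((2 : ℝ) ^ n)⁻¹) ^ (d - 1) := by
        refine (Finset.abs_sum_le_sum_abs _ _).trans (Finset.sum_le_sum fun i _ => ?_)
        refine (abs_sub _ _).trans ?_
        linarith [hF i (c + Pi.single i 1), hF i c]
    _ = _ := by simp; ring

/-- Summation by parts moves the difference from the fluxes to the values `a`: each face contributes
its area times the jump of `a` across it. The set `s` must contain the support of `a` and its shifts
by one in each direction, so that both sums can run over `s`. -/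
theorem variation_comp_cellIndex_le [NeZero d] (n : ℕ) (a : (Fin d → ℤ) → ℝ)
    (s : Finset (Fin d → ℤ)) (hs : ∀ c ∉ s, a c = 0)
    (hs' : ∀ i, ∀ c ∉ s, a (c + Pi.single i (-1)) = 0) :
    variation (fun x => a (cellIndex n x)) ≤ ENNReal.ofReal
      ((((2 : ℝ) ^ n)⁻¹) ^ (d - 1) * ∑ i, ∑ c ∈ s, |a (c + Pi.single i (-1)) - a c|) := by
  refine variation_le_ofReal fun v hv => ?_
  obtain ⟨F, hF, h⟩ := hv.exists_flux n
  have hI (c : Fin d → ℤ) : IntegrableOn (divergence v) (cell n c) :=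
    (hv.continuous_divergence.integrable_of_hasCompactSupport
      hv.hasCompactSupport_divergence).integrableOn
  have h1 : ∫ x, a (cellIndex n x) * divergence v x =
      ∑ c ∈ s, a c * ∫ x in cell n c, divergence v x := by
    simp only [← integral_indicator (measurableSet_cell n _), ← integral_const_mul]
    rw [← integral_finsetSum]
    · congr 1
      ext x
      by_cases hx : cellIndex n x ∈ s
      · rw [Finset.sum_eq_single (cellIndex n x)]
        · simp [Set.indicator, mem_cell]
        · intro c _ hc
          simp [Set.indicator, mem_cell, hc.symm]
        · exact fun h => (h hx).elim
      · rw [hs _ hx, zero_mul]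
        refine (Finset.sum_eq_zero fun c hc => ?_).symm
        have : cellIndex n x ≠ c := fun h => hx (h ▸ hc)
        simp [Set.indicator, mem_cell, this]
    · intro c _
      exact ((integrable_indicator_iff (measurableSet_cell n c)).2 (hI c)).const_mul _
  -- Both sides are sums over the whole lattice, so the shift of the index leaves no boundary terms.
  have hparts (i : Fin d) : ∑ c ∈ s, a c * F i (c + Pi.single i 1) =
      ∑ c ∈ s, a (c + Pi.single i (-1)) * F i c := by
    have e1 : ∑' c, a c * F i (c + Pi.single i 1) = ∑ c ∈ s, a c * F i (c + Pi.single i 1) :=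
      tsum_eq_sum fun c hc => by rw [hs c hc, zero_mul]
    have e2 : ∑' c, a (c + Pi.single i (-1)) * F i c =
        ∑ c ∈ s, a (c + Pi.single i (-1)) * F i c :=
      tsum_eq_sum fun c hc => by rw [hs' i c hc, zero_mul]
    rw [← e1, ← e2]
    refine ((Equiv.addRight (Pi.single i (-1) : Fin d → ℤ)).tsum_eq
      (fun c => a c * F i (c + Pi.single i 1))).symm.trans (tsum_congr fun c => ?_)
    simp [add_assoc, ← Pi.single_add]
  rw [h1]
  simp only [h, Finset.mul_sum]
  rw [Finset.sum_comm]
  refine Finset.sum_le_sum fun i _ => ?_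
  simp only [mul_sub, Finset.sum_sub_distrib]
  rw [hparts i, ← Finset.sum_sub_distrib]
  refine Finset.sum_le_sum fun c _ => ?_
  rw [← sub_mul]
  refine (le_abs_self _).trans ?_
  rw [abs_mul, mul_comm]
  gcongr
  exact hF i c

/-- The mean value of `u` on the dyadic cube of side `2⁻ⁿ` with index `c`. -/
noncomputable def cellAverage (n : ℕ) (u : Space d → ℝ) (c : Fin d → ℤ) : ℝ :=
  2 ^ (n * d) * ∫ x in cell n c, u x

theorem unitCube_ae_eq_cell (d : ℕ) : unitCube d =ᵐ[volume] cell 0 0 := by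
  have : unitCube d = box (fun i => (((0 : Fin d → ℤ) i : ℤ) : ℝ) / 2 ^ 0)
      (fun i => ((((0 : Fin d → ℤ) i : ℤ) : ℝ) + 1) / 2 ^ 0) := by
    simp [unitCube, box]
  rw [this]
  exact (cell_ae_eq_box 0 0).symm

theorem cellIndex_mem_of_mem_cell_zero {x : Space d} (hx : x ∈ cell 0 0) (n : ℕ) (i : Fin d) :
    0 ≤ cellIndex n x i ∧ cellIndex n x i < 2 ^ n := by
  have h := mem_cell_iff.1 hx i
  simp only [Pi.zero_apply, Int.cast_zero, pow_zero, div_one, zero_add] at h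
  have h2 : (0 : ℝ) < 2 ^ n := by positivity
  refine ⟨Int.floor_nonneg.2 (mul_nonneg h2.le h.1), Int.floor_lt.2 ?_⟩
  push_cast
  nlinarith [h.2]

theorem MemBV.ae_eq_zero_cell (hu : MemBV u) : ∀ᵐ x, x ∉ cell 0 0 → u x = 0 := by
  filter_upwards [hu.ae_eq_zero, (unitCube_ae_eq_cell d).mem_iff] with x h1 h2 h3
  exact h1 fun h => h3 (h2.1 h)

theorem MemBV.cellAverage_eq_zero (hu : MemBV u) (n : ℕ) {c : Fin d → ℤ}
    (hc : ¬ ∀ i, 0 ≤ c i ∧ c i < 2 ^ n) : cellAverage n u c = 0 := by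
  have : ∫ x in cell n c, u x = 0 := by
    refine integral_eq_zero_of_ae ?_
    filter_upwards [ae_restrict_of_ae hu.ae_eq_zero_cell,
      ae_restrict_mem (measurableSet_cell n c)] with x h1 h2
    exact h1 fun h3 => hc fun i => h2 ▸ cellIndex_mem_of_mem_cell_zero h3 n i
  rw [cellAverage, this, mul_zero]

/-- Total jump times area of a face; the bound does not depend on `n`. One factor `d` comes from the
translation estimate, the other from the number of directions. -/
theorem MemBV.variation_cellAverage_le [NeZero d] (hu : MemBV u) (n : ℕ) :
    variation (fun x => cellAverage n u (cellIndex n x)) ≤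
      ENNReal.ofReal (d * d * (variation u).toReal) := by
  -- The indices of the cubes in `[0,1]ᵈ` lie in `[0, 2ⁿ)`; the margin leaves room for the jumps at
  -- the boundary of the unit cube.
  let s : Finset (Fin d → ℤ) := Finset.Icc (-1) (fun _ => 2 ^ n + 1)
  have hs (c : Fin d → ℤ) (hc : c ∉ s) : ¬ ∀ i, -1 ≤ c i ∧ c i ≤ 2 ^ n + 1 := fun h =>
    hc (Finset.mem_Icc.2 ⟨fun i => (h i).1, fun i => (h i).2⟩)
  refine (variation_comp_cellIndex_le n (cellAverage n u) s (fun c hc => ?_)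
    (fun i c hc => ?_)).trans (ENNReal.ofReal_le_ofReal ?_)
  · refine hu.cellAverage_eq_zero n fun h => hs c hc fun j => ?_
    have := h j
    omega
  · refine hu.cellAverage_eq_zero n fun h => hs c hc fun j => ?_
    have := h j
    by_cases hj : j = i
    · subst hj
      simp at this
      omega
    · simp [hj] at this
      omega
  · have hpow : (((2 : ℝ) ^ n)⁻¹) ^ (d - 1) * (2 ^ (n * d) * ((2 : ℝ) ^ n)⁻¹) = 1 := by
      have : (((2 : ℝ) ^ n)⁻¹) ^ (d - 1) * ((2 : ℝ) ^ n)⁻¹ = ((2 : ℝ) ^ (n * d))⁻¹ := by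
        rw [← pow_succ, Nat.sub_add_cancel (NeZero.pos d), inv_pow, pow_mul]
      have h2 : (2 : ℝ) ^ (n * d) ≠ 0 := by positivity
      rw [mul_left_comm, this, mul_inv_cancel₀ h2]
    have key (i : Fin d) : ∑ c ∈ s, |cellAverage n u (c + Pi.single i (-1)) - cellAverage n u c| ≤
        2 ^ (n * d) * (d * ((2 : ℝ) ^ n)⁻¹ * (variation u).toReal) := by
      have := sum_abs_setIntegral_cell_sub_le n s (Pi.single i (-1)) hu
      rw [norm_shift, norm_shift_zero_single, mul_one] at this
      simp only [cellAverage, ← mul_sub, abs_mul, ← Finset.mul_sum]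
      rw [abs_of_pos (by positivity)]
      gcongr
    calc (((2 : ℝ) ^ n)⁻¹) ^ (d - 1) * ∑ i,
          ∑ c ∈ s, |cellAverage n u (c + Pi.single i (-1)) - cellAverage n u c|
        ≤ (((2 : ℝ) ^ n)⁻¹) ^ (d - 1) * ∑ _i : Fin d,
          2 ^ (n * d) * (d * ((2 : ℝ) ^ n)⁻¹ * (variation u).toReal) := by
          gcongr with i
          exact key i
      _ = ((((2 : ℝ) ^ n)⁻¹) ^ (d - 1) * (2 ^ (n * d) * ((2 : ℝ) ^ n)⁻¹)) *
          (d * d * (variation u).toReal) := by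
          simp
          ring
      _ = _ := by rw [hpow, one_mul]

end cell

/-! ### Orthogonality of the matrix `A_d` -/

section matrix

theorem haarMatrix_transpose (d : ℕ) : (haarMatrix d).transpose = haarMatrix d := by
  induction d with
  | zero => simp [haarMatrix]
  | succ d ih =>
    simp only [haarMatrix, Matrix.transpose_reindex, Matrix.fromBlocks_transpose,
      Matrix.transpose_neg, ih]

/-- In the product of the blocks the off-diagonal terms cancel and the diagonal ones double. Since
`A_d` is symmetric, this gives orthogonality of both rows and columns. -/
theorem haarMatrix_mul_self (d : ℕ) : haarMatrix d * haarMatrix d = (2 : ℝ) ^ d • 1 := by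
  induction d with
  | zero => simp [haarMatrix]
  | succ d ih =>
    have h2 : (2 : ℝ) ^ d • (1 : Matrix (Fin (2 ^ d)) (Fin (2 ^ d)) ℝ) + (2 : ℝ) ^ d • 1 =
        (2 : ℝ) ^ (d + 1) • 1 := by
      rw [← add_smul]
      congr 1
      ring
    simp only [haarMatrix, Matrix.reindex_apply, Matrix.submatrix_mul_equiv,
      Matrix.fromBlocks_multiply, Matrix.mul_neg, Matrix.neg_mul, neg_neg, ih, h2, add_neg_cancel]
    have h3 : Matrix.fromBlocks ((2 : ℝ) ^ (d + 1) • (1 : Matrix (Fin (2 ^ d)) (Fin (2 ^ d)) ℝ))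
        0 0 ((2 : ℝ) ^ (d + 1) • (1 : Matrix (Fin (2 ^ d)) (Fin (2 ^ d)) ℝ)) =
        (2 : ℝ) ^ (d + 1) • 1 := by
      rw [← Matrix.fromBlocks_one, Matrix.fromBlocks_smul, smul_zero]
    rw [h3, Matrix.submatrix_smul, Pi.smul_apply, Pi.smul_apply, Matrix.submatrix_one_equiv]

theorem abs_haarMatrix (d : ℕ) (r l : Fin (2 ^ d)) : |haarMatrix d r l| = 1 := by
  induction d with
  | zero =>
    obtain rfl : r = l := Fin.ext (by have := r.2; have := l.2; simp at *)
    exact (congrArg abs (Matrix.one_apply_eq r)).trans abs_one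
  | succ d ih =>
    simp only [haarMatrix, Matrix.reindex_apply, Matrix.submatrix_apply]
    generalize Equiv.symm _ r = a
    generalize Equiv.symm _ l = b
    rcases a with a | a <;> rcases b with b | b <;> simp [ih]

/-- Row `0` is the constant row, left out of the Haar functions. Orthogonality to it is the reason
why the other rows have sum zero. -/
theorem haarMatrix_zero_left (d : ℕ) (l : Fin (2 ^ d)) : haarMatrix d 0 l = 1 := by
  induction d with
  | zero =>
    obtain rfl : l = 0 := Fin.ext (by have := l.2; simp at *)
    exact Matrix.one_apply_eq _
  | succ d ih =>
    simp only [haarMatrix, Matrix.reindex_apply, Matrix.submatrix_apply]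
    have h0 : (finSumFinEquiv.trans (finCongr (by rw [pow_succ, mul_two] :
        2 ^ d + 2 ^ d = 2 ^ (d + 1)))).symm 0 = Sum.inl 0 := by
      rw [Equiv.symm_apply_eq]
      apply Fin.ext
      simp
    rw [h0]
    generalize Equiv.symm _ l = b
    rcases b with b | b <;> simp [ih]

theorem sum_haarMatrix_mul (d : ℕ) (r r' : Fin (2 ^ d)) :
    ∑ l, haarMatrix d r l * haarMatrix d r' l = if r = r' then 2 ^ d else 0 := by
  have h := congrFun (congrFun (haarMatrix_mul_self d) r) r'
  rw [Matrix.mul_apply] at h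
  have hT (l : Fin (2 ^ d)) : haarMatrix d l r' = haarMatrix d r' l :=
    congrFun (congrFun (haarMatrix_transpose d) r') l
  simp only [hT] at h
  rw [h]
  simp [Matrix.one_apply]

theorem sum_haarMatrix_mul' (d : ℕ) (l l' : Fin (2 ^ d)) :
    ∑ r, haarMatrix d r l * haarMatrix d r l' = if l = l' then 2 ^ d else 0 := by
  rw [← sum_haarMatrix_mul d l l']
  have hT (r l : Fin (2 ^ d)) : haarMatrix d r l = haarMatrix d l r :=
    congrFun (congrFun (haarMatrix_transpose d) l) r
  exact Finset.sum_congr rfl fun r _ => by rw [hT r l, hT r l']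

theorem sum_haarMatrix_row (d : ℕ) {r : Fin (2 ^ d)} (hr : r ≠ 0) :
    ∑ l, haarMatrix d r l = 0 := by
  have := sum_haarMatrix_mul d r 0
  simpa [haarMatrix_zero_left, hr] using this

end matrix

/-! ### Integer indices for the numbering of dyadic cubes -/

section index

variable {d : ℕ}

/-- Passing to the parent cube is floor division of the index by `2`; nesting of dyadic cubes thus
becomes integer arithmetic. -/
theorem cellIndex_succ_div_two (n : ℕ) (x : Space d) (i : Fin d) :
    cellIndex (n + 1) x i / 2 = cellIndex n x i := by
  have h1 := Int.floor_le (2 ^ (n + 1) * x i)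
  have h2 := Int.lt_floor_add_one (2 ^ (n + 1) * x i)
  have h3 := Int.floor_le (2 ^ n * x i)
  have h4 := Int.lt_floor_add_one (2 ^ n * x i)
  simp only [cellIndex]
  set a := ⌊2 ^ (n + 1) * x i⌋
  set b := ⌊2 ^ n * x i⌋
  rw [pow_succ] at h1 h2
  have h5 : a < 2 * b + 2 := by
    have : (a : ℝ) < 2 * b + 2 := by linarith
    exact_mod_cast this
  have h6 : 2 * b < a + 1 := by
    have : 2 * (b : ℝ) < a + 1 := by linarith
    exact_mod_cast this
  omega

theorem cellIndex_add_div (n p : ℕ) (x : Space d) (i : Fin d) :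
    cellIndex (n + p) x i / 2 ^ p = cellIndex n x i := by
  induction p with
  | zero => simp
  | succ p ih =>
    rw [← ih, ← cellIndex_succ_div_two (n + p), Int.ediv_ediv_of_nonneg (by norm_num), pow_succ,
      mul_comm]
    rfl

/-- The closed dyadic cube of side `2⁻ⁿ` with index `c`. -/
def closedCell (n : ℕ) (c : Fin d → ℤ) : Set (Space d) :=
  box (fun i => (c i : ℝ) / 2 ^ n) (fun i => ((c i : ℝ) + 1) / 2 ^ n)

theorem box_subset_box_iff {a b a' b' : Fin d → ℝ} (hab : a ≤ b) :
    box a b ⊆ box a' b' ↔ a' ≤ a ∧ b ≤ b' := by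
  constructor
  · intro h
    have h1 := h (show WithLp.toLp 2 a ∈ box a b from fun i => ⟨le_rfl, hab i⟩)
    have h2 := h (show WithLp.toLp 2 b ∈ box a b from fun i => ⟨hab i, le_rfl⟩)
    exact ⟨fun i => (h1 i).1, fun i => (h2 i).2⟩
  · exact fun h x hx i => ⟨(h.1 i).trans (hx i).1, (hx i).2.trans (h.2 i)⟩

theorem closedCell_lo_le_hi (n : ℕ) (c : Fin d → ℤ) :
    (fun i => (c i : ℝ) / 2 ^ n) ≤ fun i => ((c i : ℝ) + 1) / 2 ^ n := fun i => by
  dsimp only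
  gcongr
  linarith

theorem closedCell_injective (n : ℕ) : Function.Injective (closedCell (d := d) n) := by
  intro c c' h
  have h1 := ((box_subset_box_iff (closedCell_lo_le_hi n c)).1 h.subset).1
  have h2 := ((box_subset_box_iff (closedCell_lo_le_hi n c')).1 h.superset).1
  have h3 := le_antisymm h2 h1
  funext i
  have h4 := congrFun h3 i
  have : (2 : ℝ) ^ n ≠ 0 := by positivity
  simp only [div_left_inj' this] at h4
  exact_mod_cast h4

/-- After clearing denominators, the inclusion says `2 c ≤ c'` and `c' + 1 ≤ 2 (c + 1)` in each
coordinate. This translates the condition on children in `DyadicNumbering`, which concerns sets,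
into one on indices. -/
theorem closedCell_succ_subset_iff {n : ℕ} {c c' : Fin d → ℤ} :
    closedCell (n + 1) c' ⊆ closedCell n c ↔ ∀ i, c' i / 2 = c i := by
  unfold closedCell
  rw [box_subset_box_iff (closedCell_lo_le_hi (n + 1) c'), Pi.le_def, Pi.le_def, ← forall_and]
  refine forall_congr' fun i => ?_
  have h2 : (0 : ℝ) < 2 ^ n := by positivity
  rw [pow_succ, div_le_div_iff₀ h2 (by positivity), div_le_div_iff₀ (by positivity) h2]
  have e1 : (c i : ℝ) * (2 ^ n * 2) ≤ c' i * 2 ^ n ↔ 2 * c i ≤ c' i := by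
    rw [show (c i : ℝ) * (2 ^ n * 2) = (2 * c i) * 2 ^ n by ring, mul_le_mul_iff_left₀ h2]
    exact_mod_cast Iff.rfl
  have e2 : ((c' i : ℝ) + 1) * 2 ^ n ≤ (c i + 1) * (2 ^ n * 2) ↔ c' i + 1 ≤ 2 * (c i + 1) := by
    rw [show ((c i : ℝ) + 1) * (2 ^ n * 2) = (2 * (c i + 1)) * 2 ^ n by ring,
      mul_le_mul_iff_left₀ h2]
    exact_mod_cast Iff.rfl
  rw [e1, e2]
  omega

theorem isDyadicCube_iff {n : ℕ} {Q : Set (Space d)} :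
    IsDyadicCube n Q ↔ ∃ c : Fin d → ℤ, (∀ i, 0 ≤ c i ∧ c i < 2 ^ n) ∧ Q = closedCell n c := by
  constructor
  · rintro ⟨c, hc, rfl⟩
    exact ⟨fun i => c i, fun i => ⟨Int.natCast_nonneg _, by
      have := hc i
      dsimp only
      exact_mod_cast this⟩, by simp [closedCell]⟩
  · rintro ⟨c, hc, rfl⟩
    refine ⟨fun i => (c i).toNat, fun i => ?_, ?_⟩
    · have := hc i
      dsimp only
      zify
      rw [Int.toNat_of_nonneg this.1]
      exact this.2
    · have (i : Fin d) : (((c i).toNat : ℕ) : ℝ) = c i := by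
        have := Int.toNat_of_nonneg (hc i).1
        exact_mod_cast this
      simp [closedCell, this]

variable (K : DyadicNumbering d)

open Classical in
/-- The index of the dyadic cube `K_{n,k}`. -/
noncomputable def DyadicNumbering.index (n k : ℕ) : Fin d → ℤ :=
  if h : ∃ c : Fin d → ℤ, (∀ i, 0 ≤ c i ∧ c i < 2 ^ n) ∧ K.cube n k = closedCell n c then
    -- The default can occur only for `k ≥ 2^(n * d)`, where the numbering is arbitrary.
    h.choose else 0

theorem DyadicNumbering.index_spec {n k : ℕ} (hk : k < 2 ^ (n * d)) :
    (∀ i, 0 ≤ K.index n k i ∧ K.index n k i < 2 ^ n) ∧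
      K.cube n k = closedCell n (K.index n k) := by
  have h := isDyadicCube_iff.1 ((K.bijOn n).mapsTo hk)
  rw [DyadicNumbering.index, dif_pos h]
  exact h.choose_spec

theorem DyadicNumbering.index_injOn (n : ℕ) :
    Set.InjOn (K.index n) (Set.Iio (2 ^ (n * d))) := fun k hk k' hk' h =>
  (K.bijOn n).injOn hk hk' (by rw [(K.index_spec hk).2, (K.index_spec hk').2, h])

theorem DyadicNumbering.exists_index {n : ℕ} {c : Fin d → ℤ} (hc : ∀ i, 0 ≤ c i ∧ c i < 2 ^ n) :
    ∃ k < 2 ^ (n * d), K.index n k = c := by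
  obtain ⟨k, hk, h⟩ := (K.bijOn n).surjOn (isDyadicCube_iff.2 ⟨c, hc, rfl⟩)
  exact ⟨k, hk, closedCell_injective n (by rw [← (K.index_spec hk).2, h])⟩

/-- The index of the `l`-th child of `K_{n,k}`. -/
noncomputable def DyadicNumbering.child (n k : ℕ) (l : Fin (2 ^ d)) : Fin d → ℤ :=
  K.index (n + 1) (2 ^ d * k + l)

theorem child_lt {n k : ℕ} (hk : k < 2 ^ (n * d)) (l : Fin (2 ^ d)) :
    2 ^ d * k + l < 2 ^ ((n + 1) * d) := by
  have := l.2
  calc 2 ^ d * k + l < 2 ^ d * k + 2 ^ d := by omega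
    _ = 2 ^ d * (k + 1) := by ring
    _ ≤ 2 ^ d * 2 ^ (n * d) := Nat.mul_le_mul_left _ hk
    _ = 2 ^ ((n + 1) * d) := by ring

theorem DyadicNumbering.cube_child {n k : ℕ} (hk : k < 2 ^ (n * d)) (l : Fin (2 ^ d)) :
    K.cube (n + 1) (2 ^ d * k + l) = closedCell (n + 1) (K.child n k l) :=
  (K.index_spec (child_lt hk l)).2

theorem DyadicNumbering.child_div_two {n k : ℕ} (hk : k < 2 ^ (n * d)) (l : Fin (2 ^ d))
    (i : Fin d) : K.child n k l i / 2 = K.index n k i := by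
  have h := ((K.image_children n k hk).subset ⟨l, l.2, rfl⟩).2
  dsimp only at h
  rw [K.cube_child hk, (K.index_spec hk).2] at h
  exact closedCell_succ_subset_iff.1 h i

theorem DyadicNumbering.child_injective {n k : ℕ} (hk : k < 2 ^ (n * d)) :
    Function.Injective (K.child n k) := fun l l' h => by
  have := K.index_injOn (n + 1) (child_lt hk l) (child_lt hk l') h
  apply Fin.ext
  omega

theorem DyadicNumbering.exists_child {n k : ℕ} (hk : k < 2 ^ (n * d)) {c : Fin d → ℤ}
    (hc : ∀ i, c i / 2 = K.index n k i) : ∃ l, K.child n k l = c := by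
  have h0 := (K.index_spec hk).1
  have hc' : ∀ i, 0 ≤ c i ∧ c i < 2 ^ (n + 1) := fun i => by
    have h1 := h0 i
    have h2 := hc i
    rw [pow_succ]
    omega
  have hmem : closedCell (n + 1) c ∈ {Q | IsDyadicCube (n + 1) Q ∧ Q ⊆ K.cube n k} :=
    ⟨isDyadicCube_iff.2 ⟨c, hc', rfl⟩, by
      rw [(K.index_spec hk).2]
      exact closedCell_succ_subset_iff.2 hc⟩
  rw [← K.image_children n k hk] at hmem
  obtain ⟨l, hl, h⟩ := hmem
  refine ⟨⟨l, hl⟩, closedCell_injective (n + 1) ?_⟩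
  rw [← K.cube_child hk]
  exact h

end index

/-! ### Haar functions: conditional expectations and orthonormality -/

section haarFunctions

variable {d : ℕ} {f u : Space d → ℝ}

theorem ae_mem_closedCell_iff :
    ∀ᵐ x : Space d, ∀ (n : ℕ) (c : Fin d → ℤ), x ∈ closedCell n c ↔ x ∈ cell n c := by
  refine ae_all_iff.2 fun n => ae_all_iff.2 fun c => ?_
  exact (cell_ae_eq_box n c).symm.mem_iff

/-- The normalizing factor of the Haar functions of generation `n`. -/
noncomputable def haarScale (d n : ℕ) : ℝ := 2 ^ ((n * d : ℝ) / 2)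

theorem haarScale_pos (d n : ℕ) : 0 < haarScale d n := by
  unfold haarScale
  positivity

theorem haarScale_mul_self (d n : ℕ) : haarScale d n * haarScale d n = 2 ^ (n * d) := by
  unfold haarScale
  rw [← Real.rpow_add (by norm_num), add_halves]
  exact_mod_cast Real.rpow_natCast 2 (n * d)

variable (K : DyadicNumbering d)

/-- The value of `g_{n,k,r}` on the dyadic cube of side `2⁻⁽ⁿ⁺¹⁾` with index `c`. -/
noncomputable def haarValue (n k : ℕ) (r : Fin (2 ^ d)) (c : Fin d → ℤ) : ℝ :=
  haarScale d n * ∑ l, haarMatrix d r l * if c = K.child n k l then 1 else 0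

theorem ae_haar_eq : ∀ᵐ x : Space d, ∀ n, ∀ k < 2 ^ (n * d), ∀ r,
    haar K n k r x = haarValue K n k r (cellIndex (n + 1) x) := by
  filter_upwards [ae_mem_closedCell_iff] with x hx n k hk r
  unfold haar haarValue haarScale
  congr 1
  refine Finset.sum_congr rfl fun l _ => ?_
  rw [K.cube_child hk]
  simp only [Set.indicator, hx, mem_cell]

theorem haarValue_child {n k : ℕ} (hk : k < 2 ^ (n * d)) (r l : Fin (2 ^ d)) :
    haarValue K n k r (K.child n k l) = haarScale d n * haarMatrix d r l := by
  simp [haarValue, (K.child_injective hk).eq_iff]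

theorem haarValue_eq_zero {n k : ℕ} (hk : k < 2 ^ (n * d)) (r : Fin (2 ^ d)) {c : Fin d → ℤ}
    (hc : ¬ ∀ i, c i / 2 = K.index n k i) : haarValue K n k r c = 0 := by
  have (l : Fin (2 ^ d)) : c ≠ K.child n k l := fun h =>
    hc fun i => by rw [h, K.child_div_two hk]
  simp [haarValue, this]

theorem haarValue_eq_zero_of_ne {n k k' : ℕ} (hk : k < 2 ^ (n * d)) (hk' : k' < 2 ^ (n * d))
    (h : k' ≠ k) (r : Fin (2 ^ d)) {c : Fin d → ℤ} (hc : ∀ i, c i / 2 = K.index n k i) :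
    haarValue K n k' r c = 0 :=
  haarValue_eq_zero K hk' r fun hc' =>
    h (K.index_injOn n hk' hk (funext fun i => (hc' i).symm.trans (hc i)))

theorem cube_child_ae_eq {n k : ℕ} (hk : k < 2 ^ (n * d)) (l : Fin (2 ^ d)) :
    K.cube (n + 1) (2 ^ d * k + l) =ᵐ[volume] cell (n + 1) (K.child n k l) := by
  rw [K.cube_child hk]
  exact (cell_ae_eq_box _ _).symm

/-- Here `f` is any integrable function, because the formula serves for functions of bounded
variation, for Haar functions, and for divergences of test fields. -/
theorem integral_mul_haar (hf : Integrable f) {n k : ℕ} (hk : k < 2 ^ (n * d))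
    (r : Fin (2 ^ d)) :
    ∫ x, f x * haar K n k r x =
      haarScale d n * ∑ l, haarMatrix d r l * ∫ x in cell (n + 1) (K.child n k l), f x := by
  have hm (l : Fin (2 ^ d)) := (isDyadicCube_child K hk l).measurableSet
  have h1 (x : Space d) : f x * haar K n k r x = haarScale d n * ∑ l, haarMatrix d r l *
      (K.cube (n + 1) (2 ^ d * k + l)).indicator f x := by
    unfold haar haarScale
    rw [mul_left_comm, Finset.mul_sum]
    congr 1
    refine Finset.sum_congr rfl fun l _ => ?_
    by_cases hx : x ∈ K.cube (n + 1) (2 ^ d * k + l)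
    · rw [Set.indicator_of_mem hx, Set.indicator_of_mem hx]
      ring
    · simp [hx]
  simp only [h1]
  rw [integral_const_mul, integral_finsetSum]
  · congr 1
    refine Finset.sum_congr rfl fun l _ => ?_
    rw [integral_const_mul, integral_indicator (hm l), setIntegral_congr_set (cube_child_ae_eq K hk l)]
  · exact fun l _ => (hf.indicator (hm l)).const_mul _

theorem setIntegral_cell_eq_sum_child (hf : Integrable f) {n k : ℕ} (hk : k < 2 ^ (n * d)) :
    ∫ x in cell n (K.index n k), f x = ∑ l, ∫ x in cell (n + 1) (K.child n k l), f x := by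
  have hU : cell n (K.index n k) = ⋃ l, cell (n + 1) (K.child n k l) := by
    ext x
    simp only [Set.mem_iUnion, mem_cell]
    constructor
    · intro h
      obtain ⟨l, hl⟩ := K.exists_child hk (c := cellIndex (n + 1) x) fun i => by
        rw [cellIndex_succ_div_two, h]
      exact ⟨l, hl.symm⟩
    · rintro ⟨l, hl⟩
      funext i
      rw [← cellIndex_succ_div_two, hl, K.child_div_two hk]
  rw [hU, integral_iUnion_fintype (fun l => measurableSet_cell _ _)
    (fun l l' h => disjoint_cell ((K.child_injective hk).ne h)) fun l => hf.integrableOn]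

theorem sum_range_add_mul {M : Type*} [AddCommMonoid M] (F : ℕ → M) (m a b : ℕ) :
    ∑ j ∈ Finset.range (m + a * b), F j =
      ∑ j ∈ Finset.range m, F j +
        ∑ k ∈ Finset.range a, ∑ q ∈ Finset.range b, F (m + k * b + q) := by
  induction a with
  | zero => simp
  | succ a ih =>
    rw [Finset.sum_range_succ, ← add_assoc, ← ih, ← Finset.sum_range_add]
    congr 2
    ring

theorem pow_mul_add_generation (d n : ℕ) :
    2 ^ (n * d) + 2 ^ (n * d) * (2 ^ d - 1) = 2 ^ ((n + 1) * d) := by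
  have h1 : 1 ≤ 2 ^ d := Nat.one_le_two_pow
  rw [add_comm, ← Nat.mul_succ, Nat.succ_eq_add_one, Nat.sub_add_cancel h1, ← pow_add]
  ring

/-- Generation `n` fills the positions from `2^(n * d)` on, in blocks of length `2^d - 1`, one for
each cube; the shift `r - 1` appears because `r` starts at `1`. -/
theorem sum_range_generation {M : Type*} [AddCommMonoid M] (F : ℕ → M) (n : ℕ) :
    ∑ j ∈ Finset.range (2 ^ ((n + 1) * d)), F j = ∑ j ∈ Finset.range (2 ^ (n * d)), F j +
      ∑ k ∈ Finset.range (2 ^ (n * d)), ∑ r ∈ Finset.univ.erase (0 : Fin (2 ^ d)),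
        F (2 ^ (n * d) + k * (2 ^ d - 1) + (r - 1)) := by
  rw [← pow_mul_add_generation, sum_range_add_mul]
  congr 1
  refine Finset.sum_congr rfl fun k _ => ?_
  refine Finset.sum_bij' (fun q hq => ⟨q + 1, by rw [Finset.mem_range] at hq; omega⟩)
    (fun r _ => (r : ℕ) - 1) (fun q hq => ?_) (fun r hr => ?_) (fun q hq => ?_) (fun r hr => ?_)
    (fun q hq => ?_)
  · simp [Fin.ext_iff]
  · have h0 : (r : ℕ) ≠ 0 := fun h => (Finset.mem_erase.1 hr).1 (Fin.ext h)
    have := r.2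
    rw [Finset.mem_range]
    omega
  · simp
  · have h0 : (r : ℕ) ≠ 0 := fun h => (Finset.mem_erase.1 hr).1 (Fin.ext h)
    apply Fin.ext
    dsimp only
    omega
  · simp

theorem haarSeq_index' [NeZero d] {n k : ℕ} (hk : k < 2 ^ (n * d)) {r : Fin (2 ^ d)}
    (hr : r ≠ 0) : haarSeq K (2 ^ (n * d) + k * (2 ^ d - 1) + (r - 1)) = haar K n k r :=
  haarSeq_index K n k hk r (Nat.one_le_iff_ne_zero.2 fun h => hr (Fin.ext h))

theorem integral_mul_haarSeq_zero [NeZero d] (f : Space d → ℝ) :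
    ∫ x, f x * haarSeq K 0 x = ∫ x in cell 0 0, f x := by
  rw [← setIntegral_congr_set (unitCube_ae_eq_cell d),
    ← integral_indicator (isCompact_unitCube d).measurableSet]
  congr 1
  ext x
  by_cases hx : x ∈ unitCube d <;> simp [haarSeq, hx]

/-- The sum of the Haar series over the generations less than `n` is the conditional expectation
on the dyadic cubes of generation `n`. -/
theorem ae_sum_haarSeq_eq [NeZero d] (hf : Integrable f) (n : ℕ) : ∀ᵐ x, x ∈ cell 0 0 →
    ∑ j ∈ Finset.range (2 ^ (n * d)), (∫ y, f y * haarSeq K j y) * haarSeq K j x =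
      cellAverage n f (cellIndex n x) := by
  induction n with
  | zero =>
    filter_upwards [(unitCube_ae_eq_cell d).mem_iff] with x hx h0
    simp only [zero_mul, pow_zero, Finset.sum_range_one, integral_mul_haarSeq_zero]
    simp [cellAverage, haarSeq, hx.2 h0, mem_cell.1 h0]
  | succ n ih =>
    filter_upwards [ih, ae_haar_eq K] with x hx hxK h0
    obtain ⟨k, hk, hkx⟩ := K.exists_index (cellIndex_mem_of_mem_cell_zero h0 n)
    have hdiv (i : Fin d) : cellIndex (n + 1) x i / 2 = K.index n k i := by
      rw [cellIndex_succ_div_two, hkx]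
    obtain ⟨l, hl⟩ := K.exists_child hk hdiv
    -- Only the functions on the cube `K_{n,k}` that contains `x` are nonzero at `x`.
    rw [sum_range_generation, hx h0, Finset.sum_eq_single k]
    · set I : Fin (2 ^ d) → ℝ := fun l => ∫ x in cell (n + 1) (K.child n k l), f x with hI
      have hterm : ∀ r ∈ Finset.univ.erase (0 : Fin (2 ^ d)),
          (∫ y, f y * haarSeq K (2 ^ (n * d) + k * (2 ^ d - 1) + (r - 1)) y) *
            haarSeq K (2 ^ (n * d) + k * (2 ^ d - 1) + (r - 1)) x =
          2 ^ (n * d) * ∑ l', (haarMatrix d r l' * haarMatrix d r l) * I l' := fun r hr => by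
        rw [haarSeq_index' K hk (Finset.mem_erase.1 hr).1, integral_mul_haar K hf hk,
          hxK n k hk, ← hl, haarValue_child K hk, ← haarScale_mul_self, Finset.mul_sum,
          Finset.mul_sum, Finset.sum_mul]
        exact Finset.sum_congr rfl fun l' _ => by simp only [hI]; ring
      rw [Finset.sum_congr rfl hterm, ← Finset.mul_sum, Finset.sum_comm]
      -- Orthogonality of columns. Leaving out the constant row `0` produces the `-1`, whose
      -- contribution cancels the average over the parent cube given by the induction hypothesis;
      -- what remains is the average over the child.
      have hcol (l' : Fin (2 ^ d)) : ∑ r ∈ Finset.univ.erase (0 : Fin (2 ^ d)),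
          haarMatrix d r l' * haarMatrix d r l * I l' =
          ((if l' = l then 2 ^ d else 0) - 1) * I l' := by
        rw [← Finset.sum_mul, ← sum_haarMatrix_mul' d l' l,
          ← Finset.add_sum_erase _ _ (Finset.mem_univ (0 : Fin (2 ^ d)))]
        simp [haarMatrix_zero_left]
      simp only [hcol, sub_mul, one_mul, Finset.sum_sub_distrib, ite_mul, zero_mul,
        Finset.sum_ite_eq', Finset.mem_univ, if_true]
      simp only [cellAverage]
      rw [← hkx, setIntegral_cell_eq_sum_child K hf hk, ← hl]
      simp only [hI]
      ring
    · intro k' hk' hne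
      rw [Finset.mem_range] at hk'
      refine Finset.sum_eq_zero fun r hr => ?_
      rw [haarSeq_index' K hk' (Finset.mem_erase.1 hr).1, hxK n k' hk',
        haarValue_eq_zero_of_ne K hk hk' hne r hdiv, mul_zero]
    · exact fun h => (h (Finset.mem_range.2 hk)).elim

/-- For `f` constant on each child of `K_{n,k}`, the integral reduces to the product of a row of
`A_d` with the vector of values. Orthonormality then follows from the matrix. -/
theorem integral_mul_haar_of_const (hf : Integrable f) {n k : ℕ} (hk : k < 2 ^ (n * d))
    (r : Fin (2 ^ d)) (b : Fin (2 ^ d) → ℝ)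
    (hb : ∀ᵐ x, ∀ l, cellIndex (n + 1) x = K.child n k l → f x = b l) :
    ∫ x, f x * haar K n k r x =
      haarScale d n * (((2 : ℝ) ^ (n + 1))⁻¹ ^ d * ∑ l, haarMatrix d r l * b l) := by
  rw [integral_mul_haar K hf hk]
  congr 1
  rw [Finset.mul_sum]
  refine Finset.sum_congr rfl fun l _ => ?_
  have : ∫ x in cell (n + 1) (K.child n k l), f x = ∫ x in cell (n + 1) (K.child n k l), b l := by
    refine setIntegral_congr_ae (measurableSet_cell _ _) ?_
    filter_upwards [hb] with x hx hxl
    exact hx l hxl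
  rw [this, setIntegral_const, volume_real_cell, smul_eq_mul]
  ring

variable [NeZero d]

theorem haarType_ne_zero (j : ℕ) : haarType d j ≠ 0 := fun h => by
  have := congrArg Fin.val h
  simp [haarType] at this

theorem haarSeq_succ (j : ℕ) : haarSeq K (j + 1) =
    haar K (haarGen d (j + 1)) (haarCube d (j + 1)) (haarType d (j + 1)) := rfl

/-- The position is recovered from the triple by division with remainder. -/
theorem haar_index_ext {i j : ℕ} (hg : haarGen d (i + 1) = haarGen d (j + 1))
    (hc : haarCube d (i + 1) = haarCube d (j + 1)) (ht : haarType d (i + 1) = haarType d (j + 1)) :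
    i = j := by
  have h (j : ℕ) : j + 1 = 2 ^ (haarGen d (j + 1) * d) +
      ((2 ^ d - 1) * haarCube d (j + 1) + (haarType d (j + 1) - 1)) := by
    have h1 : 2 ^ (haarGen d (j + 1) * d) ≤ j + 1 := by
      rw [mul_comm, pow_mul]
      exact Nat.pow_log_le_self _ (by omega)
    simp only [haarCube, haarType, Nat.add_sub_cancel, Nat.div_add_mod]
    omega
  have hi := h i
  have hj := h j
  rw [hg, hc, ht] at hi
  omega

/-- The earlier function is constant on each child of the cube of the later one. Its values there
are all equal (earlier generation, or the first function), all zero (another cube of the same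
generation), or a multiple of another row of `A_d` (same cube). -/
theorem integral_haarSeq_mul_of_lt {i j : ℕ} (hij : i < j) :
    ∫ x, haarSeq K i x * haarSeq K j x = 0 := by
  obtain ⟨j, rfl⟩ : ∃ m, j = m + 1 := ⟨j - 1, by omega⟩
  rw [haarSeq_succ]
  set n := haarGen d (j + 1) with hn
  have hk := haarCube_lt (d := d) j
  set k := haarCube d (j + 1) with hkdef
  have hr := haarType_ne_zero (d := d) (j + 1)
  set r := haarType d (j + 1) with hrdef
  have hint := (memBV_haarSeq K i).integrable
  cases i with
  | zero =>
    rw [integral_mul_haar_of_const K hint hk r (fun _ => 1)]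
    · simp [sum_haarMatrix_row d hr]
    · filter_upwards [(unitCube_ae_eq_cell d).mem_iff] with x h0 l hl
      have hx0 : x ∈ cell 0 0 := by
        rw [mem_cell]
        funext i
        rw [← cellIndex_add_div 0 n, zero_add, ← cellIndex_succ_div_two, hl,
          K.child_div_two hk]
        exact Int.ediv_eq_zero_of_lt ((K.index_spec hk).1 i).1 ((K.index_spec hk).1 i).2
      simp [haarSeq, h0.2 hx0]
  | succ i =>
    rw [haarSeq_succ] at hint ⊢
    have hk' := haarCube_lt (d := d) i
    have hle : haarGen d (i + 1) ≤ n := Nat.log_mono_right hij.le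
    rcases hle.lt_or_eq with hlt | heq
    · set n' := haarGen d (i + 1)
      obtain ⟨p, hp⟩ : ∃ p, n = n' + 1 + p := ⟨n - (n' + 1), by omega⟩
      -- Division by `2 ^ p` gives the index of the ancestor of `K_{n,k}` of generation `n' + 1`, on
      -- which the earlier function is constant; the value does not depend on the child.
      rw [integral_mul_haar_of_const K hint hk r (fun _ => haarValue K n' (haarCube d (i + 1))
        (haarType d (i + 1)) fun i => K.index n k i / 2 ^ p)]
      · rw [← Finset.sum_mul, sum_haarMatrix_row d hr]
        simp
      · filter_upwards [ae_haar_eq K] with x hx l hl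
        rw [hx n' _ hk']
        congr 1
        funext i
        rw [← cellIndex_add_div (n' + 1) p, ← hp, ← cellIndex_succ_div_two, hl,
          K.child_div_two hk]
    · rw [heq] at hint hk' ⊢
      by_cases hkk : haarCube d (i + 1) = k
      · rw [hkk] at hint ⊢
        have hrr : r ≠ haarType d (i + 1) := fun h => by
          have := haar_index_ext heq hkk h.symm
          omega
        rw [integral_mul_haar_of_const K hint hk r
          (fun l => haarScale d n * haarMatrix d (haarType d (i + 1)) l)]
        · simp only [mul_left_comm _ (haarScale d n)]
          rw [← Finset.mul_sum, sum_haarMatrix_mul, if_neg hrr]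
          simp
        · filter_upwards [ae_haar_eq K] with x hx l hl
          rw [hx n _ hk, hl, haarValue_child K hk]
      · rw [integral_mul_haar_of_const K hint hk r (fun _ => 0)]
        · simp
        · filter_upwards [ae_haar_eq K] with x hx l hl
          rw [hx n _ hk', haarValue_eq_zero_of_ne K hk hk' hkk]
          intro i
          rw [hl, K.child_div_two hk]

theorem integral_haarSeq_mul_self (j : ℕ) : ∫ x, haarSeq K j x * haarSeq K j x = 1 := by
  cases j with
  | zero =>
    rw [integral_mul_haarSeq_zero, ← setIntegral_congr_set (unitCube_ae_eq_cell d)]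
    have : ∫ x in unitCube d, haarSeq K 0 x = ∫ x in unitCube d, (1 : ℝ) :=
      setIntegral_congr_fun (isCompact_unitCube d).measurableSet fun x hx => by
        simp [haarSeq, hx]
    rw [this, setIntegral_congr_set (unitCube_ae_eq_cell d), setIntegral_const, volume_real_cell]
    simp
  | succ j =>
    have hint := (memBV_haarSeq K (j + 1)).integrable
    rw [haarSeq_succ] at hint ⊢
    have hk := haarCube_lt (d := d) j
    set n := haarGen d (j + 1)
    rw [integral_mul_haar_of_const K hint hk _
      (fun l => haarScale d n * haarMatrix d (haarType d (j + 1)) l)]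
    · simp only [mul_left_comm _ (haarScale d n)]
      have hvol : ((2 : ℝ) ^ (n + 1))⁻¹ ^ d * 2 ^ d * 2 ^ (n * d) = 1 := by
        rw [inv_pow, ← pow_mul, mul_assoc, ← pow_add, add_mul, one_mul, add_comm d]
        exact inv_mul_cancel₀ (by positivity)
      rw [← Finset.mul_sum, sum_haarMatrix_mul, if_pos rfl, ← hvol, ← haarScale_mul_self]
      ring
    · filter_upwards [ae_haar_eq K] with x hx l hl
      rw [hx n _ hk, hl, haarValue_child K hk]

theorem integral_haarSeq_mul (i j : ℕ) :
    ∫ x, haarSeq K i x * haarSeq K j x = if i = j then 1 else 0 := by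
  rcases lt_trichotomy i j with h | rfl | h
  · rw [integral_haarSeq_mul_of_lt K h, if_neg h.ne]
  · rw [integral_haarSeq_mul_self, if_pos rfl]
  · simp only [mul_comm (haarSeq K i _)]
    rw [integral_haarSeq_mul_of_lt K h, if_neg h.ne']

end haarFunctions

/-! ### Uniform bound for the partial sums on BV -/

section partialSums

variable {d : ℕ} {u : Space d → ℝ}

theorem BV.variation_le_norm (w : BV d) : (variation w).toReal ≤ ‖w‖ := by
  rw [BV.norm_eq]
  have : 0 ≤ ∫ x, |w x| := integral_nonneg fun x => abs_nonneg _
  linarith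

theorem BV.coe_sum_smul {ι : Type*} (s : Finset ι) (c : ι → ℝ) (w : ι → BV d) :
    (∑ j ∈ s, c j • w j : BV d) =ᵐ[volume] fun x => ∑ j ∈ s, c j * w j x := by
  classical
  induction s using Finset.induction_on with
  | empty =>
    simp only [Finset.sum_empty, map_zero]
    exact Lp.coeFn_zero _ _ _
  | insert a s ha ih =>
    simp only [Finset.sum_insert ha]
    filter_upwards [BV.coe_add (c a • w a) (∑ j ∈ s, c j • w j), BV.coe_smul (c a) (w a), ih]
      with x h1 h2 h3
    rw [h1, h2, h3]

variable (K : DyadicNumbering d)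

/-- As the row has sum zero, the integral over child `0` may be subtracted from all the others. The
offset from child `0` to child `l` may vary with `k`, since the order of the children is arbitrary;
summing over all `e` in `{-1,0,1}ᵈ` gives a bound with fixed offsets, ready to be summed over `k`.
-/
theorem abs_integral_mul_haar_le (hu : Integrable u) {n k : ℕ} (hk : k < 2 ^ (n * d))
    {r : Fin (2 ^ d)} (hr : r ≠ 0) :
    |∫ x, u x * haar K n k r x| ≤ haarScale d n * (2 ^ d *
      ∑ e ∈ Finset.Icc (-1 : Fin d → ℤ) 1, |(∫ x in cell (n + 1) (K.child n k 0 + e), u x) -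
        ∫ x in cell (n + 1) (K.child n k 0), u x|) := by
  set I : (Fin d → ℤ) → ℝ := fun c => ∫ x in cell (n + 1) c, u x with hI
  have h1 : ∑ l, haarMatrix d r l * I (K.child n k l) =
      ∑ l, haarMatrix d r l * (I (K.child n k l) - I (K.child n k 0)) := by
    simp only [mul_sub, Finset.sum_sub_distrib, ← Finset.sum_mul, sum_haarMatrix_row d hr,
      zero_mul, sub_zero]
  rw [integral_mul_haar K hu hk, h1, abs_mul, abs_of_pos (haarScale_pos d n)]
  refine mul_le_mul_of_nonneg_left ?_ (haarScale_pos d n).le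
  calc |∑ l, haarMatrix d r l * (I (K.child n k l) - I (K.child n k 0))|
      ≤ ∑ _l : Fin (2 ^ d), ∑ e ∈ Finset.Icc (-1 : Fin d → ℤ) 1,
          |I (K.child n k 0 + e) - I (K.child n k 0)| := by
        refine (Finset.abs_sum_le_sum_abs _ _).trans (Finset.sum_le_sum fun l _ => ?_)
        rw [abs_mul, abs_haarMatrix, one_mul]
        have he : K.child n k l - K.child n k 0 ∈ Finset.Icc (-1 : Fin d → ℤ) 1 := by
          have h (i : Fin d) : -1 ≤ K.child n k l i - K.child n k 0 i ∧
              K.child n k l i - K.child n k 0 i ≤ 1 := by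
            have h1 := K.child_div_two hk l i
            have h2 := K.child_div_two hk 0 i
            omega
          exact Finset.mem_Icc.2 ⟨fun i => (h i).1, fun i => (h i).2⟩
        have := Finset.single_le_sum (f := fun e => |I (K.child n k 0 + e) - I (K.child n k 0)|)
          (fun e _ => abs_nonneg _) he
        simpa using this
    _ = _ := by simp [hI]

/-- The sum of the lengths of the vectors with coordinates in `{-1, 0, 1}`. -/
noncomputable def offsetNorm (d : ℕ) : ℝ :=
  ∑ e ∈ Finset.Icc (-1 : Fin d → ℤ) 1, ‖(shift 0 e : Space d)‖

/-- For each fixed offset, the children number `0` of the different cubes are distinct cells, so the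
translation estimate applies to their sum. -/
theorem sum_abs_integral_mul_haar_le (hu : MemBV u) (n : ℕ) {r : Fin (2 ^ d)} (hr : r ≠ 0) :
    ∑ k ∈ Finset.range (2 ^ (n * d)), |∫ x, u x * haar K n k r x| ≤
      haarScale d n * (2 ^ d * (d * ((2 : ℝ) ^ (n + 1))⁻¹ * offsetNorm d *
        (variation u).toReal)) := by
  calc ∑ k ∈ Finset.range (2 ^ (n * d)), |∫ x, u x * haar K n k r x|
      ≤ ∑ k ∈ Finset.range (2 ^ (n * d)), haarScale d n * (2 ^ d *
        ∑ e ∈ Finset.Icc (-1 : Fin d → ℤ) 1, |(∫ x in cell (n + 1) (K.child n k 0 + e), u x) -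
          ∫ x in cell (n + 1) (K.child n k 0), u x|) :=
        Finset.sum_le_sum fun k hk =>
          abs_integral_mul_haar_le K hu.integrable (Finset.mem_range.1 hk) hr
    _ = haarScale d n * (2 ^ d * ∑ e ∈ Finset.Icc (-1 : Fin d → ℤ) 1,
        ∑ k ∈ Finset.range (2 ^ (n * d)), |(∫ x in cell (n + 1) (K.child n k 0 + e), u x) -
          ∫ x in cell (n + 1) (K.child n k 0), u x|) := by
        rw [← Finset.mul_sum, ← Finset.mul_sum, Finset.sum_comm]
    _ ≤ haarScale d n * (2 ^ d * ∑ e ∈ Finset.Icc (-1 : Fin d → ℤ) 1,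
        d * (((2 : ℝ) ^ (n + 1))⁻¹ * ‖(shift 0 e : Space d)‖) * (variation u).toReal) := by
        refine mul_le_mul_of_nonneg_left ?_ (haarScale_pos d n).le
        refine mul_le_mul_of_nonneg_left (Finset.sum_le_sum fun e _ => ?_) (by positivity)
        have hinj : Set.InjOn (fun k => K.child n k 0) (Finset.range (2 ^ (n * d))) := by
          intro k hk k' hk' h
          have hk := Finset.mem_range.1 hk
          have hk' := Finset.mem_range.1 hk'
          have := K.index_injOn (n + 1) (child_lt hk 0) (child_lt hk' 0) h
          have h2 : 0 < 2 ^ d := by positivity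
          simpa [h2.ne'] using this
        have := sum_abs_setIntegral_cell_sub_le (n + 1)
          ((Finset.range (2 ^ (n * d))).image fun k => K.child n k 0) e hu
        rw [Finset.sum_image hinj, norm_shift] at this
        exact this
    _ = _ := by
        rw [offsetNorm, ← Finset.sum_mul, ← Finset.mul_sum, ← Finset.mul_sum, mul_assoc (d : ℝ)]
        ring

variable [NeZero d]

/-- By the Poincaré inequality only variations need to be bounded. -/
theorem BV.norm_le_variation (w : BV d) : ‖w‖ ≤ (2 * d + 1) * (variation w).toReal := by
  rw [BV.norm_eq]
  linarith [w.memBV.integral_abs_le]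

/-- The function is constant on `2^d` cubes, with values `± haarScale d n`; each cube contributes
its perimeter. -/
theorem variation_haar_le {n k : ℕ} (hk : k < 2 ^ (n * d)) (r : Fin (2 ^ d)) :
    variation (haar K n k r) ≤ ENNReal.ofReal
      (haarScale d n * (2 ^ d * (2 * d * (((2 : ℝ) ^ (n + 1))⁻¹) ^ (d - 1)))) := by
  refine variation_le_ofReal fun v hv => ?_
  have hI : Integrable (divergence v) := hv.continuous_divergence.integrable_of_hasCompactSupport
    hv.hasCompactSupport_divergence
  simp only [mul_comm (haar K n k r _)]
  rw [integral_mul_haar K hI hk]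
  refine mul_le_mul_of_nonneg_left ?_ (haarScale_pos d n).le
  calc ∑ l, haarMatrix d r l * ∫ x in cell (n + 1) (K.child n k l), divergence v x
      ≤ ∑ _l : Fin (2 ^ d), 2 * d * (((2 : ℝ) ^ (n + 1))⁻¹) ^ (d - 1) := by
        refine Finset.sum_le_sum fun l _ => (le_abs_self _).trans ?_
        rw [abs_mul, abs_haarMatrix, one_mul]
        exact hv.abs_setIntegral_cell_divergence_le (n + 1) _
    _ = _ := by simp

theorem norm_haarBV_index_le {n k : ℕ} (hk : k < 2 ^ (n * d)) {r : Fin (2 ^ d)} (hr : r ≠ 0) :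
    ‖haarBV K (2 ^ (n * d) + k * (2 ^ d - 1) + (r - 1))‖ ≤ (2 * d + 1) *
      (haarScale d n * (2 ^ d * (2 * d * (((2 : ℝ) ^ (n + 1))⁻¹) ^ (d - 1)))) := by
  refine (BV.norm_le_variation _).trans ?_
  gcongr
  refine ENNReal.toReal_le_of_le_ofReal ?_ ?_
  · have := haarScale_pos d n
    positivity
  · rw [haarBV, variation_congr (BV.coe_mk _ _), haarSeq_index' K hk hr]
    exact variation_haar_le K hk r

/-- The partial sums of the Haar series are uniformly bounded on `BV([0, 1]ᵈ)`. -/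
theorem exists_norm_partialSum_le : ∃ C : ℝ, ∀ (N : ℕ) (u : BV d),
    ‖∑ j ∈ Finset.range N, (∫ x, u x * haarSeq K j x) • haarBV K j‖ ≤ C * ‖u‖ := by
  -- `C₁` is the Poincaré constant times the bound for averages. `C₂` is the product of the number
  -- of types `r` (at most `2^d`), the constant for the sum of the coefficients, and the constant
  -- for the norm of a Haar function.
  let C₁ : ℝ := (2 * d + 1) * (d * d)
  let C₂ : ℝ := 2 ^ d * ((2 ^ d * (d * offsetNorm d)) * ((2 * d + 1) * (2 ^ d * (2 * d))))
  have hoff : 0 ≤ offsetNorm d := Finset.sum_nonneg fun e _ => norm_nonneg _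
  have hC₁ : 0 ≤ C₁ := by positivity
  have hC₂ : 0 ≤ C₂ := by positivity
  refine ⟨C₁ + C₂, fun N u => ?_⟩
  have hV := u.variation_le_norm
  have hV0 : 0 ≤ (variation u).toReal := ENNReal.toReal_nonneg
  have hub := u.memBV
  -- For `N = 0` the inequality `2 ^ (n * d) ≤ N` below would fail, as `Nat.log` is then `0`.
  rcases Nat.eq_zero_or_pos N with rfl | hN
  · simp only [Finset.range_zero, Finset.sum_empty, norm_zero]
    positivity
  set g : ℕ → BV d := fun j => (∫ x, u x * haarSeq K j x) • haarBV K j with hg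
  have h1d : 1 < 2 ^ d := Nat.one_lt_two_pow (NeZero.ne d)
  set n := Nat.log (2 ^ d) N with hn
  have hlo : 2 ^ (n * d) ≤ N := by
    rw [mul_comm, pow_mul]
    exact Nat.pow_log_le_self _ (by omega)
  have hhi : N ≤ 2 ^ ((n + 1) * d) := by
    rw [mul_comm, pow_mul]
    exact (Nat.lt_pow_succ_log_self h1d N).le
  -- The complete generations add up to the averages over cubes of generation `n`, inside the unit
  -- cube by `ae_sum_haarSeq_eq`, and outside because both sides vanish.
  have hfull : ‖∑ j ∈ Finset.range (2 ^ (n * d)), g j‖ ≤ C₁ * (variation u).toReal := by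
    refine (BV.norm_le_variation _).trans ?_
    simp only [C₁, mul_assoc]
    gcongr
    rw [← mul_assoc]
    refine ENNReal.toReal_le_of_le_ofReal (by positivity) ?_
    rw [variation_congr (w := fun x => cellAverage n u (cellIndex n x))]
    · exact hub.variation_cellAverage_le n
    · have hcoe : ∀ᵐ x, ∀ j, (haarBV K j : Space d → ℝ) x = haarSeq K j x :=
        ae_all_iff.2 fun j => BV.coe_mk _ _
      have hzero : ∀ᵐ x, ∀ j, x ∉ cell 0 0 → haarSeq K j x = 0 :=
        ae_all_iff.2 fun j => (memBV_haarSeq K j).ae_eq_zero_cell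
      filter_upwards [BV.coe_sum_smul (Finset.range (2 ^ (n * d)))
        (fun j => ∫ x, u x * haarSeq K j x) (haarBV K), hcoe, hzero,
        ae_sum_haarSeq_eq K hub.integrable n] with x h1 h2 h3 h4
      rw [h1]
      simp only [h2]
      by_cases hx : x ∈ cell 0 0
      · exact h4 hx
      · rw [hub.cellAverage_eq_zero n]
        · exact Finset.sum_eq_zero fun j _ => by rw [h3 j hx, mul_zero]
        · intro h
          refine hx (funext fun i => ?_)
          rw [← cellIndex_add_div 0 n, zero_add]
          exact Int.ediv_eq_zero_of_lt (h i).1 (h i).2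
  -- The incomplete generation is bounded by the sum of the norms over the whole generation.
  have hgen : ‖∑ j ∈ Finset.Ico (2 ^ (n * d)) N, g j‖ ≤ C₂ * (variation u).toReal := by
    set h : ℝ := ((2 : ℝ) ^ (n + 1))⁻¹ with hh
    have hh0 : 0 < h := by positivity
    set s : ℝ := haarScale d n with hs
    have hs0 : 0 < s := haarScale_pos d n
    set M : ℝ := (2 * d + 1) * (s * (2 ^ d * (2 * d * h ^ (d - 1)))) with hM
    have hM0 : 0 ≤ M := by positivity
    -- The two normalizing factors, one from the coefficient and one from the norm, compensate for
    -- the powers `h` and `h ^ (d - 1)` of the side.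
    have hscale : s * s * h ^ d ≤ 1 := by
      rw [hs, haarScale_mul_self, hh, inv_pow, ← pow_mul, ← div_eq_mul_inv]
      refine div_le_one_of_le₀ ?_ (by positivity)
      exact pow_le_pow_right₀ (by norm_num) (Nat.mul_le_mul_right d n.le_succ)
    have hpow : h ^ (d - 1) * h = h ^ d := by
      rw [← pow_succ, Nat.sub_add_cancel (NeZero.pos d)]
    calc ‖∑ j ∈ Finset.Ico (2 ^ (n * d)) N, g j‖
        ≤ ∑ j ∈ Finset.Ico (2 ^ (n * d)) N, ‖g j‖ := norm_sum_le _ _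
      _ ≤ ∑ j ∈ Finset.Ico (2 ^ (n * d)) (2 ^ ((n + 1) * d)), ‖g j‖ :=
          Finset.sum_le_sum_of_subset_of_nonneg (Finset.Ico_subset_Ico_right hhi)
            fun _ _ _ => norm_nonneg _
      _ = ∑ k ∈ Finset.range (2 ^ (n * d)), ∑ r ∈ Finset.univ.erase (0 : Fin (2 ^ d)),
          ‖g (2 ^ (n * d) + k * (2 ^ d - 1) + (r - 1))‖ := by
          rw [Finset.sum_Ico_eq_sub _ (hlo.trans hhi), sum_range_generation, add_sub_cancel_left]
      _ ≤ ∑ k ∈ Finset.range (2 ^ (n * d)), ∑ r ∈ Finset.univ.erase (0 : Fin (2 ^ d)),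
          |∫ x, u x * haar K n k r x| * M := by
          refine Finset.sum_le_sum fun k hk => Finset.sum_le_sum fun r hr => ?_
          have hk := Finset.mem_range.1 hk
          have hr := (Finset.mem_erase.1 hr).1
          simp only [hg]
          rw [norm_smul, Real.norm_eq_abs, haarSeq_index' K hk hr]
          gcongr
          exact norm_haarBV_index_le K hk hr
      _ = ∑ r ∈ Finset.univ.erase (0 : Fin (2 ^ d)),
          (∑ k ∈ Finset.range (2 ^ (n * d)), |∫ x, u x * haar K n k r x|) * M := by
          rw [Finset.sum_comm]
          simp only [Finset.sum_mul]
      _ ≤ ∑ r ∈ Finset.univ.erase (0 : Fin (2 ^ d)),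
          (s * (2 ^ d * (d * h * offsetNorm d * (variation u).toReal))) * M := by
          refine Finset.sum_le_sum fun r hr => ?_
          gcongr
          exact sum_abs_integral_mul_haar_le K hub n (Finset.mem_erase.1 hr).1
      _ ≤ ∑ _r : Fin (2 ^ d),
          (s * (2 ^ d * (d * h * offsetNorm d * (variation u).toReal))) * M :=
          Finset.sum_le_sum_of_subset_of_nonneg (Finset.erase_subset _ _)
            fun _ _ _ => by positivity
      _ = (s * s * (h ^ (d - 1) * h)) * (C₂ * (variation u).toReal) := by
          simp only [Finset.sum_const, Finset.card_univ, Fintype.card_fin, nsmul_eq_mul, hM, C₂]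
          push_cast
          ring
      _ ≤ 1 * (C₂ * (variation u).toReal) := by
          rw [hpow]
          gcongr
      _ = _ := one_mul _
  calc ‖∑ j ∈ Finset.range N, g j‖
      = ‖∑ j ∈ Finset.range (2 ^ (n * d)), g j + ∑ j ∈ Finset.Ico (2 ^ (n * d)) N, g j‖ := by
        rw [Finset.sum_range_add_sum_Ico _ hlo]
    _ ≤ C₁ * (variation u).toReal + C₂ * (variation u).toReal :=
        (norm_add_le _ _).trans (add_le_add hfull hgen)
    _ = (C₁ + C₂) * (variation u).toReal := by ring
    _ ≤ (C₁ + C₂) * ‖u‖ := by gcongr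

end partialSums

/-! ### Density of the Haar functions and the Schauder basis -/

section basis

variable {d : ℕ}

theorem dist_le_of_cellIndex_eq {n : ℕ} {x y : Space d} (h : cellIndex n x = cellIndex n y) :
    dist x y ≤ d * (1 / 2) ^ n := by
  have hx (i : Fin d) : ‖(x - y) i‖ ≤ (1 / 2) ^ n := by
    have h1 := mem_cell_iff.1 (mem_cell.2 (rfl : cellIndex n x = cellIndex n x)) i
    have h2 := mem_cell_iff.1 (mem_cell.2 h.symm) i
    have h3 : ((cellIndex n x i : ℝ) + 1) / 2 ^ n = (cellIndex n x i : ℝ) / 2 ^ n + (1 / 2) ^ n := by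
      rw [add_div, one_div_pow]
    rw [h3] at h1 h2
    rw [PiLp.sub_apply, Real.norm_eq_abs, abs_le]
    constructor <;> linarith [h1.1, h1.2, h2.1, h2.2]
  have hsum : x - y = ∑ i, (x - y) i • EuclideanSpace.single i (1 : ℝ) := by
    ext j
    simp [Finset.sum_apply, Pi.single_apply]
  rw [dist_eq_norm, hsum]
  refine (norm_sum_le _ _).trans ?_
  calc ∑ i, ‖(x - y) i • EuclideanSpace.single i (1 : ℝ)‖ ≤ ∑ _i : Fin d, ((1 : ℝ) / 2) ^ n := by
        refine Finset.sum_le_sum fun i _ => ?_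
        rw [norm_smul, PiLp.norm_single, norm_one, mul_one]
        exact hx i
    _ = _ := by simp

theorem abs_cellAverage_sub_le {g : Space d → ℝ} (hg : Integrable g) {n : ℕ} {x : Space d} {ε : ℝ}
    (h : ∀ y, cellIndex n y = cellIndex n x → |g y - g x| ≤ ε) :
    |cellAverage n g (cellIndex n x) - g x| ≤ ε := by
  have hpow : (2 : ℝ) ^ (n * d) * ((2 : ℝ) ^ n)⁻¹ ^ d = 1 := by
    rw [inv_pow, ← pow_mul]
    exact mul_inv_cancel₀ (by positivity)
  have hvol := volume_real_cell n (cellIndex n x)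
  have hfin : volume (cell n (cellIndex n x)) < ∞ := by
    refine lt_of_le_of_ne le_top fun htop => ?_
    rw [measureReal_def, htop, ENNReal.toReal_top] at hvol
    exact absurd hvol (by positivity)
  have h1 : cellAverage n g (cellIndex n x) - g x =
      2 ^ (n * d) * ∫ y in cell n (cellIndex n x), (g y - g x) := by
    rw [integral_sub hg.integrableOn (integrableOn_const hfin.ne), setIntegral_const, hvol,
      smul_eq_mul, mul_sub, ← mul_assoc, hpow, one_mul, cellAverage]
  have h2 := norm_setIntegral_le_of_norm_le_const (μ := volume) (f := fun y => g y - g x) hfin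
    (fun y hy => h y hy)
  rw [hvol, Real.norm_eq_abs] at h2
  rw [h1, abs_mul, abs_of_pos (by positivity)]
  calc (2 : ℝ) ^ (n * d) * |∫ y in cell n (cellIndex n x), (g y - g x)|
      ≤ 2 ^ (n * d) * (ε * ((2 : ℝ) ^ n)⁻¹ ^ d) := by gcongr
    _ = ε := by rw [mul_left_comm, hpow, mul_one]

theorem cubeMeasure_univ (d : ℕ) : cubeMeasure d Set.univ = 1 := by
  rw [Measure.restrict_apply_univ, measure_congr (unitCube_ae_eq_cell d)]
  have := volume_real_cell 0 (0 : Fin d → ℤ)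
  simp only [pow_zero, inv_one, one_pow, measureReal_def] at this
  exact (ENNReal.toReal_eq_one_iff _).1 this

variable [NeZero d] (K : DyadicNumbering d)

/-- The Haar functions span a dense subspace of `L^d([0, 1]ᵈ)`. -/
theorem mem_closure_span_haarLp (f : Lp ℝ d (cubeMeasure d)) :
    f ∈ (Submodule.span ℝ (Set.range (haarLp K))).topologicalClosure := by
  refine Metric.mem_closure_iff.2 fun ε hε => ?_
  -- As `d` is finite, `f` is close in `L^d` to a continuous function with compact support. By
  -- uniform continuity that function is uniformly close to its averages over small dyadic cubes,
  -- which are partial Haar sums.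
  obtain ⟨g, hgc, hfg, hgcont, hgLp⟩ :=
    (Lp.memLp f).exists_hasCompactSupport_eLpNorm_sub_le (ENNReal.natCast_ne_top d)
      (ε := ENNReal.ofReal (ε / 3)) (by simpa using hε)
  have hgi : Integrable g := hgcont.integrable_of_hasCompactSupport hgc
  obtain ⟨δ, hδ, hgu⟩ := Metric.uniformContinuous_iff.1
    (hgc.uniformContinuous_of_continuous hgcont) (ε / 3) (by positivity)
  obtain ⟨n, hn⟩ : ∃ n : ℕ, d * ((1 : ℝ) / 2) ^ n < δ := by
    have := (tendsto_pow_atTop_nhds_zero_of_lt_one (r := (1 : ℝ) / 2) (by norm_num)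
      (by norm_num)).const_mul (d : ℝ)
    rw [mul_zero] at this
    exact (this.eventually_lt_const hδ).exists
  set c : ℕ → ℝ := fun j => ∫ y, g y * haarSeq K j y
  set S : Lp ℝ d (cubeMeasure d) := ∑ j ∈ Finset.range (2 ^ (n * d)), c j • haarLp K j with hS
  refine ⟨S, Submodule.sum_mem _ fun j _ =>
    Submodule.smul_mem _ _ (Submodule.subset_span ⟨j, rfl⟩), ?_⟩
  have hScoe : ∀ᵐ x ∂cubeMeasure d, S x =
      ∑ j ∈ Finset.range (2 ^ (n * d)), c j * haarSeq K j x := by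
    have hsum : ∀ s : Finset ℕ, ∀ᵐ x ∂cubeMeasure d,
        (∑ j ∈ s, c j • haarLp K j : Lp ℝ d (cubeMeasure d)) x =
          ∑ j ∈ s, c j * haarSeq K j x := by
      intro s
      induction s using Finset.induction_on with
      | empty =>
        simp only [Finset.sum_empty]
        exact Lp.coeFn_zero _ _ _
      | insert a s ha ih =>
        simp only [Finset.sum_insert ha]
        filter_upwards [ih, Lp.coeFn_add (c a • haarLp K a) (∑ j ∈ s, c j • haarLp K j),
          Lp.coeFn_smul (c a) (haarLp K a), (memLp_haarSeq K a).coeFn_toLp] with x h1 h2 h3 h4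
        rw [h2, Pi.add_apply, h1, h3, Pi.smul_apply, smul_eq_mul, haarLp, h4]
    exact hsum _
  have hgS : eLpNorm (g - ⇑S) d (cubeMeasure d) ≤ ENNReal.ofReal (ε / 3) := by
    refine (eLpNorm_le_of_ae_bound (C := ε / 3) ?_).trans ?_
    · filter_upwards [hScoe, ae_restrict_of_ae (ae_sum_haarSeq_eq K hgi n),
        ae_restrict_of_ae (unitCube_ae_eq_cell d).mem_iff,
        ae_restrict_mem (isCompact_unitCube d).measurableSet] with x h1 h2 h3 h4
      rw [Pi.sub_apply, h1, h2 (h3.1 h4), norm_sub_rev]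
      refine abs_cellAverage_sub_le hgi fun y hy => ?_
      exact (hgu ((dist_le_of_cellIndex_eq hy).trans_lt hn)).le
    · rw [cubeMeasure_univ]
      simp
  have hlt : eLpNorm (⇑f - ⇑S) d (cubeMeasure d) ≤ ENNReal.ofReal (ε / 3 + ε / 3) := by
    rw [ENNReal.ofReal_add (by positivity) (by positivity)]
    calc eLpNorm (⇑f - ⇑S) d (cubeMeasure d)
        = eLpNorm ((⇑f - g) + (g - ⇑S)) d (cubeMeasure d) := by rw [sub_add_sub_cancel]
      _ ≤ eLpNorm (⇑f - g) d (cubeMeasure d) + eLpNorm (g - ⇑S) d (cubeMeasure d) :=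
          eLpNorm_add_le ((Lp.aestronglyMeasurable f).sub hgLp.1)
            (hgLp.1.sub (Lp.aestronglyMeasurable S)) Fact.out
      _ ≤ _ := add_le_add hfg hgS
  rw [Lp.dist_def]
  refine (ENNReal.toReal_le_of_le_ofReal (by positivity) hlt).trans_lt (by linarith)

theorem T_haarLp_apply (j : ℕ) (u : BV d) :
    T d (haarLp K j) u = ∫ x, u x * haarSeq K j x := by
  have h : ∫ x in unitCube d, u x * haarSeq K j x = ∫ x, u x * haarSeq K j x := by
    refine setIntegral_eq_integral_of_ae_compl_eq_zero ?_
    filter_upwards [u.memBV.ae_eq_zero] with x hx h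
    rw [hx h, zero_mul]
  rw [T_apply, ← h]
  refine integral_congr_ae ?_
  filter_upwards [(memLp_haarSeq K j).coeFn_toLp] with x hx
  rw [haarLp, hx, mul_comm]

theorem T_haarLp_haarBV (i j : ℕ) : T d (haarLp K i) (haarBV K j) = if i = j then 1 else 0 := by
  rw [T_haarLp_apply, ← integral_haarSeq_mul K i j]
  refine integral_congr_ae ?_
  filter_upwards [BV.coe_mk _ (memBV_haarSeq K j)] with x hx
  rw [haarBV, hx, mul_comm]

/-- The partial sums of the Haar series of a functional. -/
noncomputable def haarProj (N : ℕ) (α : StrongDual ℝ (BV d)) : StrongDual ℝ (BV d) :=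
  ∑ j ∈ Finset.range N, α (haarBV K j) • T d (haarLp K j)

/-- Duality: the partial sum of functionals is the transpose of the partial sum operator on BV, and
inherits its norm bound. -/
theorem haarProj_apply (N : ℕ) (α : StrongDual ℝ (BV d)) (u : BV d) :
    haarProj K N α u =
      α (∑ j ∈ Finset.range N, (∫ x, u x * haarSeq K j x) • haarBV K j) := by
  simp [haarProj, T_haarLp_apply, mul_comm]

theorem haarProj_sub (N : ℕ) (α β : StrongDual ℝ (BV d)) :
    haarProj K N (α - β) = haarProj K N α - haarProj K N β := by
  ext u
  simp [haarProj, sub_mul]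

theorem exists_norm_haarProj_le :
    ∃ C : ℝ, 0 ≤ C ∧ ∀ N (α : StrongDual ℝ (BV d)), ‖haarProj K N α‖ ≤ C * ‖α‖ := by
  obtain ⟨C, hC⟩ := exists_norm_partialSum_le K
  refine ⟨max C 0, le_max_right _ _, fun N α => ?_⟩
  refine ContinuousLinearMap.opNorm_le_bound _ (by positivity) fun u => ?_
  rw [haarProj_apply]
  calc _ ≤ ‖α‖ * ‖∑ j ∈ Finset.range N, (∫ x, u x * haarSeq K j x) • haarBV K j‖ :=
        α.le_opNorm _
    _ ≤ ‖α‖ * (max C 0 * ‖u‖) := by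
        gcongr
        exact (hC N u).trans (by gcongr; exact le_max_left _ _)
    _ = _ := by ring

/-- By biorthogonality each `T_g` is reproduced once `N` exceeds its position; a finite combination
is then reproduced for large `N`. -/
theorem eventually_haarProj_eq {β : StrongDual ℝ (BV d)}
    (hβ : β ∈ Submodule.span ℝ (Set.range fun j => T d (haarLp K j))) :
    ∀ᶠ N in atTop, haarProj K N β = β := by
  induction hβ using Submodule.span_induction with
  | mem x hx =>
    obtain ⟨j, rfl⟩ := hx
    filter_upwards [eventually_gt_atTop j] with N hN
    simp [haarProj, T_haarLp_haarBV, hN]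
  | zero => simp [haarProj]
  | add x y _ _ hx hy =>
    filter_upwards [hx, hy] with N h1 h2
    nth_rw 2 [← h1, ← h2]
    simp [haarProj, add_smul, Finset.sum_add_distrib]
  | smul c x _ hx =>
    filter_upwards [hx] with N h1
    nth_rw 2 [← h1]
    simp [haarProj, Finset.smul_sum, mul_smul]

/-- Continuity of `T` carries density of the Haar functions in `L^d` over to the range of `T`, and
SCH is the closure of that range. -/
theorem SCH_le_closure_span : SCH d ≤
    (Submodule.span ℝ (Set.range fun j => T d (haarLp K j))).topologicalClosure := by
  refine Submodule.topologicalClosure_minimal _ ?_ (Submodule.isClosed_topologicalClosure _)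
  rintro _ ⟨f, rfl⟩
  have h := image_closure_subset_closure_image (T d).continuous
    ⟨f, mem_closure_span_haarLp K f, rfl⟩
  refine closure_mono ?_ h
  rintro _ ⟨g, hg, rfl⟩
  have hmap := Submodule.mem_map_of_mem
    (f := (T d : Lp ℝ d (cubeMeasure d) →ₗ[ℝ] StrongDual ℝ (BV d))) hg
  rw [Submodule.map_span, ← Set.range_comp] at hmap
  exact hmap

theorem tendsto_haarProj {α : StrongDual ℝ (BV d)} (hα : α ∈ SCH d) :
    Tendsto (fun N => haarProj K N α) atTop (𝓝 α) := by
  obtain ⟨C, hC0, hC⟩ := exists_norm_haarProj_le K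
  rw [Metric.tendsto_nhds]
  intro ε hε
  -- In `C + 1`, the `C` accounts for the partial sum of `α - β` and the `1` for `α - β` itself.
  obtain ⟨β, hβ, hd⟩ := Metric.mem_closure_iff.1 (SCH_le_closure_span K hα) (ε / (C + 1))
    (by positivity)
  filter_upwards [eventually_haarProj_eq K hβ] with N hN
  rw [dist_eq_norm] at hd ⊢
  have h1 : haarProj K N α - α = haarProj K N (α - β) - (α - β) := by
    rw [haarProj_sub, hN]
    abel
  rw [h1]
  calc ‖haarProj K N (α - β) - (α - β)‖ ≤ C * ‖α - β‖ + ‖α - β‖ :=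
        (norm_sub_le _ _).trans (add_le_add (hC N _) le_rfl)
    _ = (C + 1) * ‖α - β‖ := by ring
    _ < (C + 1) * (ε / (C + 1)) := by gcongr
    _ = ε := by field_simp

/-- Evaluation at the `j`-th Haar function, as a functional on `SCH([0, 1]ᵈ)`. -/
noncomputable def haarCoord (j : ℕ) : StrongDual ℝ (SCH d) :=
  (ContinuousLinearMap.apply ℝ ℝ (haarBV K j)).comp (SCH d).subtypeL

theorem haarCoord_apply (j : ℕ) (α : SCH d) :
    haarCoord K j α = (α : StrongDual ℝ (BV d)) (haarBV K j) := rfl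

theorem haarCoord_haarCharge (i j : ℕ) :
    haarCoord K i (haarCharge K j) = if j = i then 1 else 0 :=
  T_haarLp_haarBV K j i

theorem tendsto_sum_haarCoord (α : SCH d) :
    Tendsto (fun N => ∑ j ∈ Finset.range N, haarCoord K j α • haarCharge K j) atTop (𝓝 α) := by
  rw [tendsto_subtype_rng]
  refine (tendsto_haarProj K α.2).congr fun N => ?_
  simp only [haarProj, haarCoord_apply, Submodule.coe_sum, Submodule.coe_smul]
  rfl

/-- Apply the continuous evaluation at the `i`-th Haar function to the partial sums: by
biorthogonality the result is `a i` as soon as `N > i`. -/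
theorem eq_haarCoord_of_tendsto {α : SCH d} {a : ℕ → ℝ}
    (h : Tendsto (fun N => ∑ j ∈ Finset.range N, a j • haarCharge K j) atTop (𝓝 α)) (i : ℕ) :
    a i = haarCoord K i α := by
  refine tendsto_nhds_unique (tendsto_const_nhds.congr' ?_)
    (((haarCoord K i).continuous.tendsto α).comp h)
  filter_upwards [eventually_gt_atTop i] with N hN
  simp [haarCoord_haarCharge, hN]

/-- The Schauder basis of `SCH([0, 1]ᵈ)` given by the Haar functions. -/
noncomputable def haarBasis : SchauderBasis ℝ (SCH d) where
  basis := haarCharge K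
  coord := haarCoord K
  ortho i j := by
    rw [haarCoord_haarCharge]
    rcases eq_or_ne j i with rfl | h
    · simp
    · simp [h, h.symm]
  expansion α := by
    -- The expansion is a conditional sum, that is, convergence of the partial sums over initial
    -- segments in the given order.
    rw [HasSum, SummationFilter.conditional_filter_eq_map_range, tendsto_map'_iff]
    exact tendsto_sum_haarCoord K α

end basis

end StrongCharge

theorem mainTheorem4 (d : ℕ) [NeZero d] (K : DyadicNumbering d) :
    -- the sequence `T_g` is a Schauder basis of `SCH([0, 1]ᵈ)`
    (∀ α : SCH d, ∃! a : ℕ → ℝ,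
      Tendsto (fun N => ∑ j ∈ Finset.range N, a j • haarCharge K j) atTop (𝓝 α)) ∧
    -- the decomposition of a strong charge functional, in the norm of `BV([0, 1]ᵈ)^*`
    (∀ α : SCH d,
      Tendsto (fun N => ∑ j ∈ Finset.range N,
        (α : StrongDual ℝ (BV d)) (haarBV K j) • T d (haarLp K j)) atTop
        (𝓝 (α : StrongDual ℝ (BV d)))) ∧
    -- the same, in terms of Mathlib's bundled Schauder bases
    ∃ b : SchauderBasis ℝ (SCH d),
      (∀ j, b j = haarCharge K j) ∧
      ∀ j (α : SCH d), b.coord j α = (α : StrongDual ℝ (BV d)) (haarBV K j) :=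
  ⟨fun α => ⟨fun j => haarCoord K j α, tendsto_sum_haarCoord K α,
      fun _ ha => funext fun i => eq_haarCoord_of_tendsto K ha i⟩,
    fun α => tendsto_haarProj K α.2,
    haarBasis K, fun _ => rfl, fun _ _ => rfl⟩
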